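/- Let $n\ge 0$, let $\mathcal K(\mathbb R^n)$ be the set of convex bodies (nonempty compact convex subsets) of $\mathbb R^n$ with the Hausdorff metric, and let $M(\mathbb R^n)$ be the space of complex Borel measures on $\mathbb R^n$ with the total variation norm $\|\cdot\|$. A translation invariant curvature measure is a map $\Phi\colon\mathcal K(\mathbb R^n)\to M(\mathbb R^n)$, $\Phi(K,\beta):=\Phi(K)(\beta)$, such that (a) if $U\subset\mathbb R^n$ is open and $K\cap U=L\cap U$, then $\Phi(K,\beta)=\Phi(L,\beta)$ for every Borel set $\beta\subset U$; (b) $\Phi(K+x,\beta+x)=\Phi(K,\beta)$ for all $K$, all Borel sets $\beta$ and all $x\in\mathbb R^n$; (c) if $K_i\to K$, then $\Phi(K_i)\to\Phi(K)$ weakly, that is, when integrated against every bounded continuous function. Let $\operatorname{Curv}(\mathbb R^n)$ be the complex vector space of these maps, and write $\Phi(K,f)=\int f\,d\Phi(K)$. Let $B\subset\mathbb R^n$ be a bounded set containing the origin in its interior. The topology of compact convergence on $\operatorname{Curv}(\mathbb R^n)$ is the one generated by $$p_{B,\mathcal F}(\Phi)=\sup_{K\subset B,\ f\in\mathcal F}|\Phi(K,f)|,\qquad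 \mathcal F\subset C_0(\mathbb R^n)\text{ compact},$$ where $C_0(\mathbb R^n)$ is the space of continuous complex functions vanishing at infinity with the sup norm. 1. The $p_{B,\mathcal F}$ are (finite) seminorms, and the topology of compact convergence is a Hausdorff locally convex vector space topology on $\operatorname{Curv}(\mathbb R^n)$, which is complete (every Cauchy net converges). 2. $\|\Phi\|_B=\sup_{K\subset B}\|\Phi(K)\|$ is a (finite) norm on $\operatorname{Curv}(\mathbb R^n)$, and it is complete. -/

import Mathlib

open MeasureTheory Filter Topology
open scoped ENNReal NNReal BoundedContinuousFunction ZeroAtInfty Uniformity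

namespace CurvatureMeasure

noncomputable section

/-- Euclidean space `ℝⁿ`. -/
abbrev Eucl (n : ℕ) : Type := EuclideanSpace ℝ (Fin n)

/-- `M(ℝⁿ)`: the complex Borel measures on `ℝⁿ`. -/
abbrev M (n : ℕ) : Type := ComplexMeasure (Eucl n)

/-- The integral `∫ f dμ` of a complex function against a complex measure. -/
def integral {n : ℕ} (μ : M n) (f : Eucl n → ℂ) : ℂ :=
  VectorMeasure.integral μ f (ContinuousLinearMap.mul ℝ ℂ)

/-- The total variation of a complex measure is finite. -/
theorem isFiniteMeasure_variation {n : ℕ} (μ : M n) : IsFiniteMeasure μ.variation := by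
  have key : ∀ (s : SignedMeasure (Eucl n)) (i : Set (Eucl n)), MeasurableSet i →
      ‖s i‖ₑ ≤ s.totalVariation i := by
    intro s i hi
    have h := congrArg (fun t : SignedMeasure (Eucl n) => t i)
      s.toSignedMeasure_toJordanDecomposition
    simp only [JordanDecomposition.toSignedMeasure, Measure.toSignedMeasure_sub_apply hi] at h
    rw [← h, SignedMeasure.totalVariation, Measure.add_apply]
    refine (enorm_sub_le).trans (add_le_add ?_ ?_) <;>
    · rw [Real.enorm_eq_ofReal (by positivity)]
      exact ENNReal.ofReal_toReal_le
  have hle : μ.variation ≤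
      (ComplexMeasure.re μ).totalVariation + (ComplexMeasure.im μ).totalVariation := by
    refine VectorMeasure.variation_le_of_forall_enorm_le fun i hi => ?_
    rw [Measure.add_apply]
    refine le_trans ?_ (add_le_add (key _ i hi) (key _ i hi))
    have hre : ComplexMeasure.re μ i = (μ i).re := rfl
    have him : ComplexMeasure.im μ i = (μ i).im := rfl
    rw [hre, him, ← ofReal_norm, ← ofReal_norm, ← ofReal_norm,
      ← ENNReal.ofReal_add (norm_nonneg _) (norm_nonneg _)]
    exact ENNReal.ofReal_le_ofReal (Complex.norm_le_abs_re_add_abs_im _)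
  exact isFiniteMeasure_of_le _ hle

theorem integrable_bcf {n : ℕ} (μ : M n) (f : Eucl n →ᵇ ℂ) : μ.Integrable f :=
  have := isFiniteMeasure_variation μ
  f.integrable μ.variation

theorem integral_zero_measure {n : ℕ} (f : Eucl n → ℂ) : integral (0 : M n) f = 0 :=
  VectorMeasure.integral_zero_vectorMeasure

theorem integral_add_measure {n : ℕ} (μ ν : M n) (f : Eucl n →ᵇ ℂ) :
    integral (μ + ν) f = integral μ f + integral ν f :=
  VectorMeasure.integral_add_vectorMeasure (integrable_bcf μ f) (integrable_bcf ν f)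

theorem integral_sub_measure {n : ℕ} (μ ν : M n) (f : Eucl n →ᵇ ℂ) :
    integral (μ - ν) f = integral μ f - integral ν f :=
  VectorMeasure.integral_sub_vectorMeasure (integrable_bcf μ f) (integrable_bcf ν f)

theorem integral_smul_measure {n : ℕ} (c : ℂ) (μ : M n) (f : Eucl n →ᵇ ℂ) :
    integral (c • μ) f = c * integral μ f := by
  have main : ∀ g : Eucl n → ℂ, MeasureTheory.Integrable g μ.variation →
      integral (c • μ) g = c * integral μ g := by
    have hmono : ∀ g : Eucl n → ℂ, MeasureTheory.Integrable g μ.variation →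
        MeasureTheory.Integrable g (c • μ).variation := by
      intro g hg
      rw [VectorMeasure.variation_smul]
      exact hg.smul_measure_nnreal
    intro g hg
    refine hg.induction (fun g => integral (c • μ) g = c * integral μ g) ?_ ?_ ?_ ?_
    · intro z s hs hfin
      have hfin' : (c • μ).variation s ≠ ∞ := by
        have := isFiniteMeasure_variation (c • μ)
        exact measure_ne_top _ _
      have h1 : integral (c • μ) (s.indicator fun _ => z) = z * (c • μ) s :=
        setToFun_indicator_const _ hs hfin' z
      have h2 : integral μ (s.indicator fun _ => z) = z * μ s :=
        setToFun_indicator_const _ hs hfin.ne z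
      rw [h1, h2, smul_apply, smul_eq_mul]
      ring
    · intro u v _ hu hv h1 h2
      have e1 : integral (c • μ) (u + v) = integral (c • μ) u + integral (c • μ) v :=
        VectorMeasure.integral_add (hmono u hu) (hmono v hv)
      have e2 : integral μ (u + v) = integral μ u + integral μ v :=
        VectorMeasure.integral_add hu hv
      rw [e1, e2, h1, h2, mul_add]
    · refine isClosed_eq ?_ ?_
      · refine continuous_iff_continuousAt.2 fun u => ?_
        refine VectorMeasure.tendsto_integral_of_L1 _
          (hmono _ (L1.integrable_coeFn u)).aestronglyMeasurable
          (Eventually.of_forall fun v => hmono _ (L1.integrable_coeFn v)) ?_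
        have h0 : Tendsto (fun v : Lp ℂ 1 μ.variation => ‖c‖ₑ * edist v u) (𝓝 u) (𝓝 0) := by
          have : Tendsto (fun v : Lp ℂ 1 μ.variation => edist v u) (𝓝 u) (𝓝 0) :=
            tendsto_iff_edist_tendsto_0.1 tendsto_id
          simpa using ENNReal.Tendsto.const_mul this (Or.inr (by simp))
        refine h0.congr fun v => ?_
        rw [VectorMeasure.variation_smul, lintegral_smul_measure, Lp.edist_def,
          eLpNorm_one_eq_lintegral_enorm]
        rfl
      · exact continuous_const.mul VectorMeasure.continuous_integral
    · intro u v huv _ h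
      have huv' : u =ᵐ[(c • μ).variation] v := by
        rw [VectorMeasure.variation_smul]
        exact Measure.smul_absolutelyContinuous.ae_eq huv
      have e1 : integral (c • μ) u = integral (c • μ) v := VectorMeasure.integral_congr_ae huv'
      have e2 : integral μ u = integral μ v := VectorMeasure.integral_congr_ae huv
      rw [← e1, ← e2, h]
  exact main f (integrable_bcf μ f)

/-- The translate `K + x` of a convex body. -/
def translate {n : ℕ} (K : ConvexBody (Eucl n)) (x : Eucl n) : ConvexBody (Eucl n) where
  carrier := (fun y => y + x) '' (K : Set (Eucl n))
  convex' := by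
    simpa [add_comm] using K.convex.translate x
  isCompact' := K.isCompact.image (by fun_prop)
  nonempty' := K.nonempty.image _

/-- Translation invariant curvature measures. The topology on `ConvexBody` is that of the
Hausdorff metric, and `Φ K β` is the value `Φ(K, β)`. -/
structure IsCurvatureMeasure {n : ℕ} (Φ : ConvexBody (Eucl n) → M n) : Prop where
  locality : ∀ (K L : ConvexBody (Eucl n)) (U : Set (Eucl n)), IsOpen U →
    (K : Set (Eucl n)) ∩ U = (L : Set (Eucl n)) ∩ U →
    ∀ β : Set (Eucl n), MeasurableSet β → β ⊆ U → Φ K β = Φ L β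
  translation : ∀ (K : ConvexBody (Eucl n)) (x : Eucl n) (β : Set (Eucl n)), MeasurableSet β →
    Φ (translate K x) ((fun y => y + x) '' β) = Φ K β
  continuity : ∀ (K : ℕ → ConvexBody (Eucl n)) (L : ConvexBody (Eucl n)),
    Tendsto K atTop (𝓝 L) → ∀ f : Eucl n →ᵇ ℂ,
    Tendsto (fun i => integral (Φ (K i)) f) atTop (𝓝 (integral (Φ L) f))

/-- `Curv(ℝⁿ)`, the complex vector space of translation invariant curvature measures. -/
def Curv (n : ℕ) : Submodule ℂ (ConvexBody (Eucl n) → M n) where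
  carrier := {Φ | IsCurvatureMeasure Φ}
  zero_mem' :=
    { locality := fun _ _ _ _ _ _ _ _ => rfl
      translation := fun _ _ _ _ => rfl
      continuity := fun _ _ _ f => by
        simp only [Pi.zero_apply, integral_zero_measure]
        exact tendsto_const_nhds }
  add_mem' := fun {Φ Ψ} hΦ hΨ =>
    { locality := fun K L U hU h β hβ hβU => by
        simp only [Pi.add_apply, add_apply]
        rw [hΦ.locality K L U hU h β hβ hβU, hΨ.locality K L U hU h β hβ hβU]
      translation := fun K x β hβ => by
        simp only [Pi.add_apply, add_apply]
        rw [hΦ.translation K x β hβ, hΨ.translation K x β hβ]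
      continuity := fun K L h f => by
        simp only [Pi.add_apply, integral_add_measure]
        exact (hΦ.continuity K L h f).add (hΨ.continuity K L h f) }
  smul_mem' := fun c Φ hΦ =>
    { locality := fun K L U hU h β hβ hβU => by
        simp only [Pi.smul_apply, smul_apply]
        rw [hΦ.locality K L U hU h β hβ hβU]
      translation := fun K x β hβ => by
        simp only [Pi.smul_apply, smul_apply]
        rw [hΦ.translation K x β hβ]
      continuity := fun K L h f => by
        simp only [Pi.smul_apply, integral_smul_measure]
        exact (hΦ.continuity K L h f).const_mul c }

/-- `p_{B,F}(Φ) = sup {|Φ(K, f)| : K ⊆ B, f ∈ F}`, with values in `[0, ∞]`. -/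
def gauge {n : ℕ} (B : Set (Eucl n)) (F : Set C₀(Eucl n, ℂ)) (Φ : Curv n) : ℝ≥0∞ :=
  ⨆ (K : ConvexBody (Eucl n)) (_ : (K : Set (Eucl n)) ⊆ B) (f ∈ F), ‖integral (Φ.1 K) f‖ₑ

/-- `‖Φ‖_B = sup {‖Φ(K)‖ : K ⊆ B}`, with values in `[0, ∞]`, where `‖μ‖` is the total variation
norm of the complex measure `μ`. -/
def variationGauge {n : ℕ} (B : Set (Eucl n)) (Φ : Curv n) : ℝ≥0∞ :=
  ⨆ (K : ConvexBody (Eucl n)) (_ : (K : Set (Eucl n)) ⊆ B), (Φ.1 K).variation Set.univ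

/-- The (extended) pseudometric `(Φ, Ψ) ↦ p_{B,F}(Φ - Ψ)` on `Curv(ℝⁿ)`. -/
@[reducible]
def gaugeEMetric {n : ℕ} (B : Set (Eucl n)) (F : Set C₀(Eucl n, ℂ)) :
    PseudoEMetricSpace (Curv n) where
  edist Φ Ψ := gauge B F (Φ - Ψ)
  edist_self Φ := by
    simp [gauge, integral_zero_measure]
  edist_comm Φ Ψ := by
    have h : ∀ (μ ν : M n) (f : C₀(Eucl n, ℂ)), ‖integral (μ - ν) f‖ₑ = ‖integral (ν - μ) f‖ₑ := by
      intro μ ν f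
      have h1 : integral (μ - ν) f = integral μ f - integral ν f :=
        integral_sub_measure μ ν f.toBCF
      have h2 : integral (ν - μ) f = integral ν f - integral μ f :=
        integral_sub_measure ν μ f.toBCF
      rw [h1, h2, ← enorm_neg, neg_sub]
    simp only [gauge, Submodule.coe_sub, Pi.sub_apply]
    simp_rw [h]
  edist_triangle Φ Ψ Θ := by
    refine iSup₂_le fun K hK => iSup₂_le fun f hf => ?_
    have h : integral ((Φ - Θ).1 K) f = integral ((Φ - Ψ).1 K) f + integral ((Ψ - Θ).1 K) f := by
      have e : (Φ - Θ).1 K = (Φ - Ψ).1 K + (Ψ - Θ).1 K := by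
        simp
      rw [e]
      exact integral_add_measure _ _ f.toBCF
    rw [h]
    refine (enorm_add_le _ _).trans (add_le_add ?_ ?_)
    · exact le_iSup₂_of_le K hK (le_iSup₂_of_le f hf le_rfl)
    · exact le_iSup₂_of_le K hK (le_iSup₂_of_le f hf le_rfl)

/-- The topology (with its uniform structure) of compact convergence on `Curv(ℝⁿ)`: the one
generated by the `p_{B,F}`, where `F` ranges over all compact subsets of `C₀(ℝⁿ)`. -/
@[reducible]
def compactConvergence {n : ℕ} (B : Set (Eucl n)) : UniformSpace (Curv n) :=
  ⨅ F : {F : Set C₀(Eucl n, ℂ) // IsCompact F}, (gaugeEMetric B F.1).toUniformSpace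

end

end CurvatureMeasure

/-!
The idea is to regard a curvature measure `Φ` as a family of functionals `f ↦ Φ(K, f)` on
`C₀(ℝⁿ)`, and to combine functional analysis on `C₀(ℝⁿ)` with the locality of `Φ`.

Complex measures are bounded functionals on `C₀(ℝⁿ)`: the total variation is the norm of the
functional (`variation_univ_le`, `enorm_integral_le_variation_mul`), and every bounded functional
comes from a measure (`exists_functional_eq`). The latter is reduced to positive functionals by the
Riesz decomposition of the real and imaginary parts.

The seminorms are finite because the bodies in a ball form a compact set
(`isCompact_convexBody_subset`). So `K ↦ Φ(K, f)` is bounded there for each `f`, and the uniform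
boundedness principle bounds `‖Φ(K)‖` (`exists_norm_functional_le`).

The bodies `K ⊆ B` determine everything. Locality and translation invariance force `Φ(K)` to be
concentrated on `K` (`IsLocalCovariant.variation_compl_eq_zero`). A partition of unity into
functions supported in small balls then reduces `Φ(K, f)` for arbitrary `K` to finitely many values
`Φ(L, g)`, where `L` is a translate of the intersection of `K` with a small ball. This bounds
`p_{B',F}` by a multiple of `p_{B,F'}` for every ball `B'` (`exists_gauge_closedBall_le`). In
particular the seminorms separate points.

For completeness, a Cauchy filter converges at each pair `(K, f)`, uniformly for `K` in a ball and
`f` in a compact set. This makes the limit functional on `C₀(ℝⁿ)` sequentially continuous, since a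
null sequence together with its limit is compact (`continuous_of_compact_approx`). Hence the limit
functional is a measure, and the defining properties of curvature measures pass to the limit
(`exists_tendsto_integral`). A Cauchy sequence for `‖·‖_B` converges in this sense, and the
total variation is lower semicontinuous, so that it also converges for `‖·‖_B`.
-/

namespace CurvatureMeasure

variable {n : ℕ}

/-! ### Complex measures as functionals on `C₀` -/

instance (μ : M n) : IsFiniteMeasure μ.variation := isFiniteMeasure_variation μ

theorem integral_smul_fun (μ : M n) (c : ℂ) (f : Eucl n → ℂ) :
    integral μ (c • f) = c * integral μ f := by
  refine setToFun_smul _ (fun c s x => ?_) c f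
  change (c • x) * μ s = c • (x * μ s)
  rw [smul_mul_assoc]

theorem enorm_integral_le (μ : M n) (f : Eucl n → ℂ) :
    ‖integral μ f‖ₑ ≤ ∫⁻ x, ‖f x‖ₑ ∂μ.variation := by
  refine VectorMeasure.enorm_integral_le_lintegral_enorm.trans ?_
  refine mul_le_of_le_one_left (by simp) ?_
  rw [← ofReal_norm]
  simp

theorem enorm_integral_le_variation_mul (μ : M n) (f : C₀(Eucl n, ℂ)) :
    ‖integral μ f‖ₑ ≤ μ.variation Set.univ * ‖f‖ₑ := by
  refine (enorm_integral_le μ f).trans ?_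
  rw [mul_comm, ← lintegral_const]
  refine lintegral_mono fun x => ?_
  rw [← ofReal_norm, ← ofReal_norm]
  exact ENNReal.ofReal_le_ofReal (f.toBCF.norm_coe_le_norm x)

/-- Multiplication of functions in `C₀` by a bounded continuous function. -/
noncomputable def bcfMul (χ : Eucl n →ᵇ ℂ) : C₀(Eucl n, ℂ) →L[ℂ] C₀(Eucl n, ℂ) :=
  LinearMap.mkContinuous
    { toFun f :=
        { toFun := fun x => χ x * f x
          continuous_toFun := χ.continuous.mul f.continuous
          zero_at_infty' := by
            refine squeeze_zero_norm (a := fun x => ‖χ‖ * ‖f x‖) (fun x => ?_) ?_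
            · rw [norm_mul]
              exact mul_le_mul_of_nonneg_right (χ.norm_coe_le_norm x) (norm_nonneg _)
            · simpa using (f.zero_at_infty'.norm).const_mul ‖χ‖ }
      map_add' f g := by ext x; simp [mul_add]
      map_smul' c f := by ext x; simp; ring } ‖χ‖ fun f => by
    refine (BoundedContinuousFunction.norm_le (by positivity)).2 fun x => ?_
    change ‖χ x * f x‖ ≤ _
    rw [norm_mul]
    exact mul_le_mul (χ.norm_coe_le_norm x) (f.toBCF.norm_coe_le_norm x) (norm_nonneg _)
      (norm_nonneg _)

@[simp] theorem bcfMul_apply (χ : Eucl n →ᵇ ℂ) (f : C₀(Eucl n, ℂ)) (x : Eucl n) :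
    bcfMul χ f x = χ x * f x := rfl

/-- Integration against a complex measure, as a continuous linear functional on `C₀`. -/
noncomputable def functional (μ : M n) : C₀(Eucl n, ℂ) →L[ℂ] ℂ :=
  LinearMap.mkContinuous
    { toFun f := integral μ f
      map_add' f g :=
        VectorMeasure.integral_add (integrable_bcf μ f.toBCF) (integrable_bcf μ g.toBCF)
      map_smul' c f := integral_smul_fun μ c f } (μ.variation Set.univ).toReal fun f => by
    rw [← toReal_enorm, ← toReal_enorm f, ← ENNReal.toReal_mul]
    exact ENNReal.toReal_mono (ENNReal.mul_ne_top (measure_ne_top _ _) enorm_ne_top)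
      (enorm_integral_le_variation_mul μ f)

theorem integral_indicator_const (μ : M n) {s : Set (Eucl n)} (hs : MeasurableSet s) (c : ℂ) :
    integral μ (s.indicator fun _ => c) = c * μ s :=
  setToFun_indicator_const _ hs (measure_ne_top _ _) c

/-- Truncating `w` radially to the unit disc at most doubles its distance to a point `z` of the
unit disc. -/
theorem norm_sub_inv_max_smul_le {z w : ℂ} (hz : ‖z‖ ≤ 1) :
    ‖z - ((max 1 ‖w‖)⁻¹ : ℝ) • w‖ ≤ 2 * ‖z - w‖ := by
  have h1 : ‖w - ((max 1 ‖w‖)⁻¹ : ℝ) • w‖ ≤ ‖z - w‖ := by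
    rcases le_total ‖w‖ 1 with hle | hle
    · simp [max_eq_left hle]
    · have h0 : ‖w‖ ≠ 0 := by positivity
      have h2 : w - ((max 1 ‖w‖)⁻¹ : ℝ) • w = (1 - ‖w‖⁻¹ : ℝ) • w := by
        rw [max_eq_right hle, sub_smul, one_smul]
      have h3 := norm_sub_norm_le w z
      rw [norm_sub_rev] at h3
      rw [h2, norm_smul, Real.norm_of_nonneg (sub_nonneg.2 (inv_le_one_of_one_le₀ hle)), sub_mul,
        inv_mul_cancel₀ h0]
      linarith
  calc ‖z - ((max 1 ‖w‖)⁻¹ : ℝ) • w‖ = ‖(z - w) + (w - ((max 1 ‖w‖)⁻¹ : ℝ) • w)‖ := by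
        rw [sub_add_sub_cancel]
    _ ≤ ‖z - w‖ + ‖w - ((max 1 ‖w‖)⁻¹ : ℝ) • w‖ := norm_add_le _ _
    _ ≤ 2 * ‖z - w‖ := by linarith

theorem norm_inv_max_smul_le (w : ℂ) : ‖((max 1 ‖w‖)⁻¹ : ℝ) • w‖ ≤ 1 := by
  have h0 : 0 < max 1 ‖w‖ := lt_of_lt_of_le one_pos (le_max_left _ _)
  rw [norm_smul, norm_inv, Real.norm_of_nonneg h0.le, inv_mul_le_one₀ h0]
  exact le_max_right _ _

theorem continuous_inv_max_smul : Continuous fun w : ℂ => ((max 1 ‖w‖)⁻¹ : ℝ) • w := by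
  have h : Continuous fun w : ℂ => max 1 ‖w‖ := continuous_const.max continuous_norm
  exact (h.inv₀ fun w => (lt_of_lt_of_le one_pos (le_max_left _ _)).ne').smul continuous_id

theorem enorm_sub_inv_max_smul_le {z w : ℂ} (hz : ‖z‖ ≤ 1) :
    ‖z - ((max 1 ‖w‖)⁻¹ : ℝ) • w‖ₑ ≤ 2 * ‖z - w‖ₑ := by
  have h2 : (2 : ℝ≥0∞) = ENNReal.ofReal 2 := by simp
  rw [← ofReal_norm, ← ofReal_norm, h2, ← ENNReal.ofReal_mul zero_le_two]
  exact ENNReal.ofReal_le_ofReal (norm_sub_inv_max_smul_le hz)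

/-- Any measurable function bounded by `1` is approximated in `L¹` by functions in the
unit ball of `C₀`. -/
theorem exists_zeroAtInfty_lintegral_sub_le (m : Measure (Eucl n)) [IsFiniteMeasure m]
    {g : Eucl n → ℂ} (hg : Measurable g) (hg1 : ∀ x, ‖g x‖ ≤ 1) {ε : ℝ≥0∞} (hε : ε ≠ 0) :
    ∃ f : C₀(Eucl n, ℂ), ‖f‖ ≤ 1 ∧ ∫⁻ x, ‖g x - f x‖ₑ ∂m ≤ ε := by
  have hgi : Integrable g m := Integrable.of_bound hg.aestronglyMeasurable 1 (ae_of_all _ hg1)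
  obtain ⟨h, hsupp, hh, hcont, -⟩ :=
    hgi.exists_hasCompactSupport_lintegral_sub_le (ε := ε / 2) (by simpa using hε)
  obtain ⟨f, hf⟩ : ∃ f : C₀(Eucl n, ℂ), ∀ x, f x = ((max 1 ‖h x‖)⁻¹ : ℝ) • h x := by
    have hc := continuous_inv_max_smul.comp hcont
    have hs : HasCompactSupport ((fun w : ℂ => ((max 1 ‖w‖)⁻¹ : ℝ) • w) ∘ h) :=
      hsupp.comp_left (smul_zero _)
    exact ⟨⟨⟨_, hc⟩, hs.is_zero_at_infty⟩, fun _ => rfl⟩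
  have hbd : ∀ x, ‖g x - f x‖ₑ ≤ 2 * ‖g x - h x‖ₑ := by
    intro x
    rw [hf]
    exact enorm_sub_inv_max_smul_le (hg1 x)
  refine ⟨f, (BoundedContinuousFunction.norm_le zero_le_one).2 fun x => ?_, ?_⟩
  · exact (congrArg norm (hf x)).trans_le (norm_inv_max_smul_le (h x))
  · have h3 : ∫⁻ x, 2 * ‖g x - h x‖ₑ ∂m ≤ ε := by
      rw [lintegral_const_mul' _ _ (by simp)]
      refine (mul_le_mul_right hh 2).trans_eq ?_
      exact ENNReal.mul_div_cancel two_ne_zero ENNReal.ofNat_ne_top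
    exact (lintegral_mono hbd).trans h3

/-- The total variation of a complex measure is at most the norm of the functional it defines on
`C₀`. For a finite family of disjoint sets `p`, the function with the value `conj (μ p) / ‖μ p‖`
on `p` has the integral `∑ ‖μ p‖`, and it can be replaced by a function in the unit ball of `C₀`. -/
theorem variation_univ_le (μ : M n) {A : ℝ≥0∞}
    (hA : ∀ f : C₀(Eucl n, ℂ), ‖f‖ ≤ 1 → ‖integral μ f‖ₑ ≤ A) :
    μ.variation Set.univ ≤ A := by
  classical
  refine le_of_forall_lt fun b hb => ?_
  obtain ⟨P, -, hdisj, hmeas, hbP⟩ := μ.exists_lt_sum_of_lt_variation .univ hb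
  refine hbP.trans_le ?_
  let c : Set (Eucl n) → ℂ := fun p => starRingEnd ℂ (μ p) / ‖μ p‖
  have hc : ∀ p, ‖c p‖ ≤ 1 := by
    intro p
    simp only [c, norm_div, RCLike.norm_conj, Complex.norm_real, norm_norm]
    exact div_self_le_one _
  have hcμ : ∀ p, c p * μ p = (‖μ p‖ : ℂ) := by
    intro p
    by_cases h0 : μ p = 0
    · simp [h0]
    · have : (‖μ p‖ : ℂ) ≠ 0 := by simpa using h0
      simp only [c]
      rw [div_mul_eq_mul_div, Complex.conj_mul', pow_two, mul_div_assoc, div_self this, mul_one]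
  let g : Eucl n → ℂ := fun x => ∑ p ∈ P, p.indicator (fun _ => c p) x
  have hgm : Measurable g :=
    Finset.measurable_sum _ fun p hp => measurable_const.indicator (hmeas p hp)
  have hg1 : ∀ x, ‖g x‖ ≤ 1 := by
    intro x
    by_cases hx : ∃ p ∈ P, x ∈ p
    · obtain ⟨p, hp, hxp⟩ := hx
      have : g x = c p := by
        simp only [g]
        rw [Finset.sum_eq_single_of_mem p hp, Set.indicator_of_mem hxp]
        intro q hq hqp
        refine Set.indicator_of_notMem (fun hxq => ?_) _
        exact Set.disjoint_left.1 (hdisj hq hp hqp) hxq hxp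
      rw [this]; exact hc p
    · push Not at hx
      have : g x = 0 := Finset.sum_eq_zero fun p hp => Set.indicator_of_notMem (hx p hp) _
      simp [this]
  have hgi : ∀ p ∈ P, μ.Integrable (p.indicator fun _ => c p) := fun p hp =>
    MeasureTheory.Integrable.indicator (integrable_const (c p)) (hmeas p hp)
  have hint : integral μ g = ∑ p ∈ P, (‖μ p‖ : ℂ) := by
    have : integral μ g = ∑ p ∈ P, integral μ (p.indicator fun _ => c p) :=
      VectorMeasure.integral_finsetSum P hgi
    rw [this]
    exact Finset.sum_congr rfl fun p hp => by rw [integral_indicator_const μ (hmeas p hp), hcμ]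
  have henorm : ∑ p ∈ P, ‖μ p‖ₑ = ‖integral μ g‖ₑ := by
    rw [hint, ← Complex.ofReal_sum, ← ofReal_norm, Complex.norm_real,
      Real.norm_of_nonneg (by positivity), ENNReal.ofReal_sum_of_nonneg (fun _ _ => norm_nonneg _)]
    exact Finset.sum_congr rfl fun p _ => (ofReal_norm _).symm
  have hgI : μ.Integrable g :=
    Integrable.of_bound hgm.aestronglyMeasurable 1 (ae_of_all _ hg1)
  rw [henorm]
  refine ENNReal.le_of_forall_pos_le_add fun ε hε _ => ?_
  obtain ⟨f, hf1, hf⟩ := exists_zeroAtInfty_lintegral_sub_le μ.variation hgm hg1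
    (ε := ε) (by simpa using hε.ne')
  have hsplit : integral μ g = integral μ f + integral μ (fun x => g x - f x) := by
    have : integral μ (fun x => g x - f x) = integral μ g - integral μ f :=
      VectorMeasure.integral_fun_sub hgI (integrable_bcf μ f.toBCF)
    rw [this]; ring
  rw [hsplit]
  exact (enorm_add_le _ _).trans (add_le_add (hA f hf1) ((enorm_integral_le _ _).trans hf))

theorem eq_zero_of_forall_integral_eq_zero (μ : M n)
    (h : ∀ f : C₀(Eucl n, ℂ), integral μ f = 0) : μ = 0 := by
  rw [← VectorMeasure.variation_eq_zero, ← Measure.measure_univ_eq_zero]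
  exact le_antisymm (variation_univ_le μ fun f _ => by simp [h f]) zero_le

/-- A complex measure vanishes on the Borel subsets of an open set `U` when it annihilates the
functions in `C₀` that are supported in `U`. -/
theorem apply_eq_zero_of_forall_integral_eq_zero (μ : M n) {U : Set (Eucl n)} (hU : IsOpen U)
    (h : ∀ f : C₀(Eucl n, ℂ), (∀ x ∉ U, f x = 0) → integral μ f = 0)
    {β : Set (Eucl n)} (hβ : MeasurableSet β) (hβU : β ⊆ U) : μ β = 0 := by
  suffices hr : μ.restrict U = 0 by
    rw [← VectorMeasure.restrict_eq_self μ hU.measurableSet hβ hβU, hr]; rfl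
  refine eq_zero_of_forall_integral_eq_zero _ fun f => ?_
  -- the cutoffs `χ k` vanish off `U` and converge to the indicator of `U`
  have hδ : ∀ k : ℕ, 0 < 1 / ((k : ℝ) + 1) := fun k => Nat.one_div_pos_of_nat
  let χ : ℕ → Eucl n → ℂ := fun k x => ((1 - (thickenedIndicator (hδ k) Uᶜ x : ℝ) : ℝ) : ℂ)
  have hχ01 : ∀ k x, ‖χ k x‖ ≤ 1 := by
    intro k x
    have h1 : (thickenedIndicator (hδ k) Uᶜ x : ℝ) ≤ 1 := by
      exact_mod_cast thickenedIndicator_le_one (hδ k) Uᶜ x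
    have h0 : (0 : ℝ) ≤ thickenedIndicator (hδ k) Uᶜ x := NNReal.coe_nonneg _
    simp only [χ, Complex.norm_real]
    rw [Real.norm_of_nonneg (by linarith)]; linarith
  have hχc : ∀ k, Continuous (χ k) := fun k => by fun_prop
  let X : ℕ → (Eucl n →ᵇ ℂ) := fun k =>
    BoundedContinuousFunction.ofNormedAddCommGroup (χ k) (hχc k) 1 (hχ01 k)
  have hlim : Tendsto (fun k => integral μ (bcfMul (X k) f)) atTop
      (𝓝 (integral μ (U.indicator f))) := by
    refine VectorMeasure.tendsto_integral_filter_of_norm_le_const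
      (Eventually.of_forall fun k => (bcfMul (X k) f).continuous.aestronglyMeasurable)
      ⟨‖f‖, Eventually.of_forall fun k => ae_of_all _ fun x => ?_⟩ (ae_of_all _ fun x => ?_)
    · rw [bcfMul_apply, norm_mul]
      exact (mul_le_of_le_one_left (norm_nonneg _) (hχ01 k x)).trans (f.toBCF.norm_coe_le_norm x)
    · have ht := tendsto_pi_nhds.1 (thickenedIndicator_tendsto_indicator_closure hδ
        tendsto_one_div_add_atTop_nhds_zero_nat Uᶜ) x
      rw [hU.isClosed_compl.closure_eq] at ht
      have ht2 : Tendsto (fun k => bcfMul (X k) f x) atTop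
          (𝓝 (((1 - ((Uᶜ.indicator (fun _ => (1 : ℝ≥0)) x : ℝ≥0) : ℝ) : ℝ) : ℂ) * f x)) := by
        refine Tendsto.mul_const _ ((Complex.continuous_ofReal.tendsto _).comp ?_)
        exact ((NNReal.continuous_coe.tendsto _).comp ht).const_sub 1
      convert ht2 using 2
      by_cases hx : x ∈ U <;> simp [hx]
  have hz : ∀ k, integral μ (bcfMul (X k) f) = 0 := by
    refine fun k => h _ fun x hx => ?_
    have : thickenedIndicator (hδ k) Uᶜ x = 1 := thickenedIndicator_one (hδ k) Uᶜ hx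
    have h2 : X k x = 0 := by
      change ((1 - (thickenedIndicator (hδ k) Uᶜ x : ℝ) : ℝ) : ℂ) = 0
      rw [this]; simp
    rw [bcfMul_apply, h2, zero_mul]
  simp only [hz] at hlim
  rw [← tendsto_nhds_unique hlim tendsto_const_nhds]
  exact (VectorMeasure.integral_indicator hU.measurableSet).symm

theorem integral_eq_zero_of_variation_eq_zero (μ : M n) {U : Set (Eucl n)}
    (hU : μ.variation U = 0) {f : Eucl n → ℂ} (hf : ∀ x ∉ U, f x = 0) : integral μ f = 0 := by
  refine VectorMeasure.integral_eq_zero_of_ae ?_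
  filter_upwards [measure_eq_zero_iff_ae_notMem.1 hU] with x hx
  exact hf x hx

theorem integral_eq_of_eqOn (μ ν : M n) {U : Set (Eucl n)} (hU : MeasurableSet U)
    (h : ∀ β, MeasurableSet β → β ⊆ U → μ β = ν β) (f : Eucl n →ᵇ ℂ)
    (hf : ∀ x ∉ U, f x = 0) : integral μ f = integral ν f := by
  rw [← sub_eq_zero, ← integral_sub_measure]
  refine integral_eq_zero_of_variation_eq_zero _ (U := U) ?_ hf
  rw [VectorMeasure.variation_apply_eq_zero hU]
  intro t htU ht
  rw [sub_apply, h t ht htU, sub_self]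

/-! ### The Riesz representation theorem for `C₀` -/

section Riesz

open CompactlySupported

/-- A finite measure, regarded as a complex measure. -/
noncomputable def ofMeasure (m : Measure (Eucl n)) [IsFiniteMeasure m] : M n :=
  m.toSignedMeasure.toComplexMeasure 0

theorem ofMeasure_apply (m : Measure (Eucl n)) [IsFiniteMeasure m] {s : Set (Eucl n)}
    (hs : MeasurableSet s) : ofMeasure m s = (m.real s : ℂ) := by
  rw [ofMeasure, SignedMeasure.toComplexMeasure_apply, Measure.toSignedMeasure_apply_measurable hs]
  rfl

theorem variation_ofMeasure (m : Measure (Eucl n)) [IsFiniteMeasure m] :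
    (ofMeasure m).variation = m := by
  have h : ∀ s, MeasurableSet s → ‖ofMeasure m s‖ₑ = m s := by
    intro s hs
    rw [ofMeasure_apply m hs, ← ofReal_norm, Complex.norm_real,
      Real.norm_of_nonneg measureReal_nonneg, ofReal_measureReal]
  refine le_antisymm (VectorMeasure.variation_le_of_forall_enorm_le fun s hs => (h s hs).le) ?_
  refine Measure.le_iff.2 fun s hs => ?_
  rw [← h s hs]
  exact VectorMeasure.enorm_measure_le_variation _ _

theorem integral_ofMeasure (m : Measure (Eucl n)) [IsFiniteMeasure m] (f : Eucl n → ℂ) :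
    integral (ofMeasure m) f = ∫ x, f x ∂m := by
  rw [integral, VectorMeasure.integral_eq_setToFun, MeasureTheory.integral_eq_setToFun]
  simp only [variation_ofMeasure]
  refine setToFun_congr_left' _ _ (fun s hs _ => ?_) f
  refine ContinuousLinearMap.ext fun z => ?_
  change z * ofMeasure m s = weightedSMul m s z
  rw [ofMeasure_apply m hs, weightedSMul_apply, mul_comm, Complex.real_smul]

/-- A compactly supported nonnegative function as a complex function vanishing at infinity. -/
noncomputable def toZeroAtInfty (f : C_c(Eucl n, ℝ≥0)) : C₀(Eucl n, ℂ) where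
  toFun x := ((f x : ℝ) : ℂ)
  continuous_toFun := Complex.continuous_ofReal.comp (NNReal.continuous_coe.comp f.continuous)
  zero_at_infty' :=
    (f.hasCompactSupport.comp_left (g := fun r : ℝ≥0 => ((r : ℝ) : ℂ)) (by simp)).is_zero_at_infty

@[simp] theorem toZeroAtInfty_apply (f : C_c(Eucl n, ℝ≥0)) (x : Eucl n) :
    toZeroAtInfty f x = ((f x : ℝ) : ℂ) := rfl

theorem exists_forall_le_const (f : C_c(Eucl n, ℝ≥0)) : ∃ c : ℝ≥0, 0 < c ∧ ∀ x, f x ≤ c := by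
  refine ⟨max ‖toZeroAtInfty f‖₊ 1, lt_max_of_lt_right one_pos, fun x => le_max_of_le_left ?_⟩
  have h : ‖((f x : ℝ) : ℂ)‖ ≤ ‖toZeroAtInfty f‖ := (toZeroAtInfty f).toBCF.norm_coe_le_norm x
  rw [Complex.norm_real, Real.norm_of_nonneg (NNReal.coe_nonneg _)] at h
  exact h

theorem rieszMeasure_univ_le (L : C_c(Eucl n, ℝ≥0) →ₗ[ℝ≥0] ℝ≥0) {A : ℝ≥0}
    (hA : ∀ f : C_c(Eucl n, ℝ≥0), (∀ x, f x ≤ 1) → L f ≤ A) :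
    NNRealRMK.rieszMeasure L Set.univ ≤ A := by
  rw [isOpen_univ.measure_eq_iSup_isCompact]
  refine iSup₂_le fun K _ => iSup_le fun hK => ?_
  obtain ⟨f, hf1, -, hfs, hf01⟩ := exists_continuous_one_zero_of_isCompact hK
    (isClosed_empty (X := Eucl n)) (Set.disjoint_empty K)
  let g : C_c(Eucl n, ℝ≥0) :=
    ⟨⟨fun x => (f x).toNNReal, by fun_prop⟩, hfs.comp_left (g := Real.toNNReal) (by simp)⟩
  have hg1 : ∀ x, g x ≤ 1 := fun x => by
    change (f x).toNNReal ≤ 1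
    simpa using (hf01 x).2
  have hgK : ∀ x ∈ K, g x = 1 := fun x hx => by
    change (f x).toNNReal = 1
    simp [hf1 hx]
  calc NNRealRMK.rieszMeasure L K = ∫⁻ x in K, 1 ∂NNRealRMK.rieszMeasure L := by simp
    _ = ∫⁻ x in K, g x ∂NNRealRMK.rieszMeasure L :=
        setLIntegral_congr_fun hK.measurableSet fun x hx => by simp [hgK x hx]
    _ ≤ ∫⁻ x, g x ∂NNRealRMK.rieszMeasure L := setLIntegral_le_lintegral _ _
    _ = L g := NNRealRMK.lintegral_rieszMeasure L g
    _ ≤ A := by exact_mod_cast hA g hg1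

/-- Riesz decomposition: a functional on the cone of nonnegative compactly supported functions
that is bounded on the functions with values in `[0, 1]` is a difference of two finite measures.
The first one represents `f ↦ sup {u g : 0 ≤ g ≤ f}`. -/
theorem exists_measure_integral_sub (u : C_c(Eucl n, ℝ≥0) → ℝ)
    (hadd : ∀ f g, u (f + g) = u f + u g) (hsmul : ∀ (c : ℝ≥0) f, u (c • f) = c * u f)
    {A : ℝ≥0} (hA : ∀ f : C_c(Eucl n, ℝ≥0), (∀ x, f x ≤ 1) → |u f| ≤ A) :
    ∃ μ ν : Measure (Eucl n), IsFiniteMeasure μ ∧ IsFiniteMeasure ν ∧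
      ∀ f, u f = ∫ x, (f x : ℝ) ∂μ - ∫ x, (f x : ℝ) ∂ν := by
  have hzero : u 0 = 0 := by simpa using hsmul 0 0
  have hbound : ∀ (c : ℝ≥0), 0 < c → ∀ f : C_c(Eucl n, ℝ≥0), (∀ x, f x ≤ c) → |u f| ≤ c * A := by
    intro c hc f hf
    have h1 : u f = c * u (c⁻¹ • f) := by
      rw [← hsmul, smul_smul, mul_inv_cancel₀ hc.ne', one_smul]
    rw [h1, abs_mul, abs_of_nonneg c.coe_nonneg]
    refine mul_le_mul_of_nonneg_left (hA _ fun x => ?_) c.coe_nonneg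
    simpa [smul_eq_mul, inv_mul_le_one₀ hc] using hf x
  let P : C_c(Eucl n, ℝ≥0) → ℝ := fun f => sSup (u '' Set.Iic f)
  have hne : ∀ f, (u '' Set.Iic f).Nonempty := fun f => ⟨u f, f, Set.mem_Iic.2 le_rfl, rfl⟩
  have hbdd : ∀ f, BddAbove (u '' Set.Iic f) := by
    intro f
    obtain ⟨c, hc, hfc⟩ := exists_forall_le_const f
    refine ⟨c * A, ?_⟩
    rintro _ ⟨g, hg, rfl⟩
    exact (le_abs_self _).trans (hbound c hc g fun x => (hg x).trans (hfc x))
  have hle : ∀ {f g}, g ≤ f → u g ≤ P f := fun {f g} h => le_csSup (hbdd f) ⟨g, h, rfl⟩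
  have hPle : ∀ {f} {a : ℝ}, (∀ g ≤ f, u g ≤ a) → P f ≤ a := by
    intro f a h
    refine csSup_le (hne f) ?_
    rintro _ ⟨g, hg, rfl⟩
    exact h g hg
  have hPadd : ∀ f g, P (f + g) = P f + P g := by
    intro f g
    refine le_antisymm (hPle fun h hh => ?_) ?_
    · -- a function `h ≤ f + g` splits into `h ⊓ f ≤ f` and a rest `k ≤ g`
      obtain ⟨k, hk⟩ := CompactlySupportedContinuousMap.exists_add_of_le (inf_le_left : h ⊓ f ≤ h)
      rw [← hk, hadd]
      refine add_le_add (hle inf_le_right) (hle fun x => ?_)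
      have h1 : h x ⊓ f x + k x = h x := DFunLike.congr_fun hk x
      have h2 : h x ≤ f x + g x := hh x
      rcases le_total (h x) (f x) with h3 | h3
      · rw [inf_eq_left.2 h3, add_eq_left] at h1
        rw [h1]; exact zero_le
      · rw [inf_eq_right.2 h3] at h1
        rw [← h1] at h2
        exact le_of_add_le_add_left h2
    · rw [← le_sub_iff_add_le]
      refine hPle fun f' hf' => ?_
      rw [le_sub_iff_add_le, ← le_sub_iff_add_le']
      refine hPle fun g' hg' => ?_
      rw [le_sub_iff_add_le', ← hadd]
      exact hle fun x => add_le_add (hf' x) (hg' x)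
  have hPsmul_ge : ∀ (c : ℝ≥0) f, 0 < c → c * P f ≤ P (c • f) := by
    intro c f hc
    rw [← le_div_iff₀' (by exact_mod_cast hc)]
    refine hPle fun g hg => ?_
    rw [le_div_iff₀' (by exact_mod_cast hc), ← hsmul]
    exact hle fun x => mul_le_mul_right (hg x) c
  have hPzero : P 0 = 0 := by
    refine le_antisymm (hPle fun g hg => ?_) (hzero.symm.le.trans (hle le_rfl))
    have : g = 0 := by
      ext x
      exact congrArg _ (le_antisymm (hg x) zero_le)
    rw [this, hzero]
  have hPsmul : ∀ (c : ℝ≥0) f, P (c • f) = c * P f := by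
    intro c f
    rcases eq_or_lt_of_le (zero_le : 0 ≤ c) with rfl | hc
    · simp [hPzero]
    · refine le_antisymm ?_ (hPsmul_ge c f hc)
      have h := hPsmul_ge c⁻¹ (c • f) (by positivity)
      rw [smul_smul, inv_mul_cancel₀ hc.ne', one_smul, NNReal.coe_inv,
        inv_mul_le_iff₀ (by exact_mod_cast hc)] at h
      exact h
  have hPnonneg : ∀ f, 0 ≤ P f := fun f => hzero.symm.le.trans (hle fun x => zero_le)
  have hPu : ∀ f, 0 ≤ P f - u f := fun f => sub_nonneg.2 (hle le_rfl)
  let L₁ : C_c(Eucl n, ℝ≥0) →ₗ[ℝ≥0] ℝ≥0 :=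
    { toFun f := ⟨P f, hPnonneg f⟩
      map_add' f g := NNReal.eq (hPadd f g)
      map_smul' c f := NNReal.eq (hPsmul c f) }
  let L₂ : C_c(Eucl n, ℝ≥0) →ₗ[ℝ≥0] ℝ≥0 :=
    { toFun f := ⟨P f - u f, hPu f⟩
      map_add' f g := NNReal.eq (by
        change P (f + g) - u (f + g) = (P f - u f) + (P g - u g)
        rw [hPadd, hadd]; ring)
      map_smul' c f := NNReal.eq (by
        change P (c • f) - u (c • f) = c * (P f - u f)
        rw [hPsmul, hsmul]; ring) }
  have hPA : ∀ f : C_c(Eucl n, ℝ≥0), (∀ x, f x ≤ 1) → P f ≤ A := fun f hf =>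
    hPle fun g hg => (le_abs_self _).trans (hA g fun x => (hg x).trans (hf x))
  refine ⟨NNRealRMK.rieszMeasure L₁, NNRealRMK.rieszMeasure L₂, ⟨?_⟩, ⟨?_⟩, fun f => ?_⟩
  · exact (rieszMeasure_univ_le L₁ (A := A) fun f hf => NNReal.coe_le_coe.1 (hPA f hf)).trans_lt
      ENNReal.coe_lt_top
  · refine (rieszMeasure_univ_le L₂ (A := A + A) fun f hf => NNReal.coe_le_coe.1 ?_).trans_lt
      ENNReal.coe_lt_top
    change P f - u f ≤ A + A
    linarith [hPA f hf, neg_abs_le (u f), hA f hf]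
  · rw [NNRealRMK.integral_rieszMeasure, NNRealRMK.integral_rieszMeasure]
    change u f = P f - (P f - u f)
    ring

/-- Compactly supported functions are dense in `C₀`. -/
theorem exists_hasCompactSupport_norm_sub_le (f : C₀(Eucl n, ℂ)) {ε : ℝ} (hε : 0 < ε) :
    ∃ g : C₀(Eucl n, ℂ), HasCompactSupport g ∧ ‖f - g‖ ≤ ε := by
  obtain ⟨K, hK, hKε⟩ : ∃ K : Set (Eucl n), IsCompact K ∧ ∀ x ∉ K, ‖f x‖ ≤ ε := by
    have h := (tendsto_zero_iff_norm_tendsto_zero.1 f.zero_at_infty').eventually (Iic_mem_nhds hε)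
    obtain ⟨K, hK, hKs⟩ := mem_cocompact.1 h
    exact ⟨K, hK, fun x hx => hKs hx⟩
  obtain ⟨φ, hφ1, -, hφs, hφ01⟩ := exists_continuous_one_zero_of_isCompact hK
    (isClosed_empty (X := Eucl n)) (Set.disjoint_empty K)
  have hs : HasCompactSupport fun x => (φ x : ℂ) * f x :=
    (hφs.comp_left (g := fun r : ℝ => (r : ℂ)) Complex.ofReal_zero).mul_right
  let g : C₀(Eucl n, ℂ) := ⟨⟨fun x => (φ x : ℂ) * f x, by fun_prop⟩, hs.is_zero_at_infty⟩
  refine ⟨g, hs, (BoundedContinuousFunction.norm_le hε.le).2 fun x => ?_⟩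
  change ‖f x - (φ x : ℂ) * f x‖ ≤ ε
  by_cases hx : x ∈ K
  · rw [hφ1 hx]; simpa using hε.le
  · have h1 : f x - (φ x : ℂ) * f x = ((1 - φ x : ℝ) : ℂ) * f x := by push_cast; ring
    rw [h1, norm_mul, Complex.norm_real, Real.norm_of_nonneg (by linarith [(hφ01 x).2])]
    exact (mul_le_of_le_one_left (norm_nonneg _) (by linarith [(hφ01 x).1])).trans (hKε x hx)

theorem exists_nnreal_eq_toNNReal_comp (f : C₀(Eucl n, ℂ)) (hf : HasCompactSupport f) (g : ℂ → ℝ)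
    (hg : Continuous g) (hg0 : g 0 = 0) :
    ∃ h : C_c(Eucl n, ℝ≥0), ∀ x, h x = (g (f x)).toNNReal :=
  ⟨⟨⟨fun x => (g (f x)).toNNReal, by fun_prop⟩,
    hf.comp_left (g := fun z => (g z).toNNReal) (by simp [hg0])⟩, fun _ => rfl⟩

theorem exists_toZeroAtInfty_decomposition (f : C₀(Eucl n, ℂ)) (hf : HasCompactSupport f) :
    ∃ a b c d : C_c(Eucl n, ℝ≥0), f = toZeroAtInfty a - toZeroAtInfty b +
      Complex.I • (toZeroAtInfty c - toZeroAtInfty d) := by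
  obtain ⟨a, ha⟩ := exists_nnreal_eq_toNNReal_comp f hf Complex.re (by fun_prop) (by simp)
  obtain ⟨b, hb⟩ := exists_nnreal_eq_toNNReal_comp f hf (fun z => -z.re) (by fun_prop) (by simp)
  obtain ⟨c, hc⟩ := exists_nnreal_eq_toNNReal_comp f hf Complex.im (by fun_prop) (by simp)
  obtain ⟨d, hd⟩ := exists_nnreal_eq_toNNReal_comp f hf (fun z => -z.im) (by fun_prop) (by simp)
  refine ⟨a, b, c, d, ?_⟩
  ext x
  have key : ∀ r : ℝ, ((r.toNNReal : ℝ) : ℂ) - (((-r).toNNReal : ℝ) : ℂ) = r := by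
    intro r
    rw [← Complex.ofReal_sub, Real.coe_toNNReal', Real.coe_toNNReal',
      max_zero_sub_max_neg_zero_eq_self]
  change f x = ((a x : ℝ) : ℂ) - ((b x : ℝ) : ℂ) +
    Complex.I * (((c x : ℝ) : ℂ) - ((d x : ℝ) : ℂ))
  rw [ha, hb, hc, hd, key, key, mul_comm, Complex.re_add_im]

/-- Riesz representation: every bounded linear functional on `C₀` is integration against a complex
measure. -/
theorem exists_functional_eq (Λ : C₀(Eucl n, ℂ) →L[ℂ] ℂ) : ∃ μ : M n, functional μ = Λ := by
  have hι_add : ∀ f g : C_c(Eucl n, ℝ≥0),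
      toZeroAtInfty (f + g) = toZeroAtInfty f + toZeroAtInfty g := by
    intro f g; ext x; simp
  have hι_smul : ∀ (c : ℝ≥0) (f : C_c(Eucl n, ℝ≥0)),
      toZeroAtInfty (c • f) = ((c : ℝ) : ℂ) • toZeroAtInfty f := by
    intro c f; ext x; simp
  have hι_norm : ∀ f : C_c(Eucl n, ℝ≥0), (∀ x, f x ≤ 1) → ‖Λ (toZeroAtInfty f)‖ ≤ ‖Λ‖₊ := by
    intro f hf
    refine (Λ.le_opNorm _).trans (mul_le_of_le_one_right (norm_nonneg _) ?_)
    refine (BoundedContinuousFunction.norm_le zero_le_one).2 fun x => ?_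
    change ‖((f x : ℝ) : ℂ)‖ ≤ 1
    rw [Complex.norm_real, Real.norm_of_nonneg (NNReal.coe_nonneg _)]
    exact_mod_cast hf x
  obtain ⟨μ₁, ν₁, hμ₁, hν₁, h₁⟩ := exists_measure_integral_sub
    (fun f => (Λ (toZeroAtInfty f)).re) (fun f g => by simp [hι_add])
    (fun c f => by simp [hι_smul, -Complex.coe_smul])
    fun f hf => (Complex.abs_re_le_norm _).trans (hι_norm f hf)
  obtain ⟨μ₂, ν₂, hμ₂, hν₂, h₂⟩ := exists_measure_integral_sub
    (fun f => (Λ (toZeroAtInfty f)).im) (fun f g => by simp [hι_add])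
    (fun c f => by simp [hι_smul, -Complex.coe_smul])
    fun f hf => (Complex.abs_im_le_norm _).trans (hι_norm f hf)
  let μ : M n := (ofMeasure μ₁ - ofMeasure ν₁) + Complex.I • (ofMeasure μ₂ - ofMeasure ν₂)
  have hpos : ∀ f : C_c(Eucl n, ℝ≥0), functional μ (toZeroAtInfty f) = Λ (toZeroAtInfty f) := by
    intro f
    have hI : ∀ (m : Measure (Eucl n)) [IsFiniteMeasure m],
        integral (ofMeasure m) (toZeroAtInfty f).toBCF = ((∫ x, (f x : ℝ) ∂m : ℝ) : ℂ) := by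
      intro m _
      rw [integral_ofMeasure, ← integral_complex_ofReal]
      rfl
    change integral μ (toZeroAtInfty f).toBCF = _
    rw [integral_add_measure, integral_smul_measure, integral_sub_measure, integral_sub_measure,
      hI, hI, hI, hI, ← Complex.ofReal_sub, ← Complex.ofReal_sub, ← h₁, ← h₂, mul_comm,
      Complex.re_add_im]
  refine ⟨μ, ContinuousLinearMap.ext fun f => ?_⟩
  have hdense : f ∈ closure {g : C₀(Eucl n, ℂ) | HasCompactSupport g} := by
    refine Metric.mem_closure_iff.2 fun ε hε => ?_
    obtain ⟨g, hg, hfg⟩ := exists_hasCompactSupport_norm_sub_le f (half_pos hε)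
    exact ⟨g, hg, by rw [dist_eq_norm]; linarith⟩
  refine closure_minimal (fun g hg => ?_)
    (isClosed_eq (functional μ).continuous Λ.continuous) hdense
  obtain ⟨a, b, c, d, rfl⟩ := exists_toZeroAtInfty_decomposition g hg
  simp only [Set.mem_ofPred_eq, map_add, map_sub, map_smul, hpos]

end Riesz

/-! ### Locality and translation covariance -/

@[simp] theorem coe_translate (K : ConvexBody (Eucl n)) (x : Eucl n) :
    (translate K x : Set (Eucl n)) = (fun y => y + x) '' (K : Set (Eucl n)) := rfl

/-- The translation `f ↦ f (· + x)` on `C₀`. -/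
noncomputable def translateFun (x : Eucl n) : C₀(Eucl n, ℂ) →L[ℂ] C₀(Eucl n, ℂ) :=
  LinearMap.mkContinuous
    (ZeroAtInftyContinuousMap.compLinearMap
      ⟨⟨fun y => y + x, by fun_prop⟩, (Homeomorph.addRight x).isClosedEmbedding.tendsto_cocompact⟩)
    1 fun f => by
      rw [one_mul]
      exact (BoundedContinuousFunction.norm_le (norm_nonneg f)).2 fun y =>
        f.toBCF.norm_coe_le_norm (y + x)

/-- Maps from convex bodies to complex measures that are local and translation covariant, but
not necessarily continuous. These two properties of a limit of curvature measures are used in the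
proof of its continuity. -/
structure IsLocalCovariant (Φ : ConvexBody (Eucl n) → M n) : Prop where
  locality : ∀ (K L : ConvexBody (Eucl n)) (U : Set (Eucl n)), IsOpen U →
    (K : Set (Eucl n)) ∩ U = (L : Set (Eucl n)) ∩ U →
    ∀ β : Set (Eucl n), MeasurableSet β → β ⊆ U → Φ K β = Φ L β
  translation : ∀ (K : ConvexBody (Eucl n)) (x : Eucl n) (β : Set (Eucl n)), MeasurableSet β →
    Φ (translate K x) ((fun y => y + x) '' β) = Φ K β

theorem IsCurvatureMeasure.isLocalCovariant {Φ : ConvexBody (Eucl n) → M n}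
    (h : IsCurvatureMeasure Φ) : IsLocalCovariant Φ :=
  ⟨h.locality, h.translation⟩

namespace IsLocalCovariant

variable {Φ : ConvexBody (Eucl n) → M n} (hΦ : IsLocalCovariant Φ)
include hΦ

theorem translate_eq_map (K : ConvexBody (Eucl n)) (x : Eucl n) :
    Φ (translate K x) = (Φ K).map (MeasurableEquiv.addRight x) := by
  ext β hβ
  rw [VectorMeasure.map_apply _ (MeasurableEquiv.addRight x).measurable hβ,
    ← hΦ.translation K x _ ((MeasurableEquiv.addRight x).measurable hβ)]
  congr 1
  exact (Set.image_preimage_eq _ (MeasurableEquiv.addRight x).surjective).symm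

theorem integral_translate (K : ConvexBody (Eucl n)) (x : Eucl n) (f : Eucl n → ℂ) :
    integral (Φ (translate K x)) f = integral (Φ K) fun y => f (y + x) := by
  rw [hΦ.translate_eq_map]
  exact VectorMeasure.integral_map_equiv (MeasurableEquiv.addRight x) f

/-- A body may be exchanged for any other body missing `U`, hence for points `y` far
away. By translation covariance, the mass of `β` becomes the mass of `β - y` for the body `{0}`.
These masses are all equal and belong to disjoint sets, so that they vanish. -/
theorem apply_eq_zero_of_disjoint (K : ConvexBody (Eucl n)) {U : Set (Eucl n)} (hU : IsOpen U)
    (hUb : Bornology.IsBounded U) (hKU : Disjoint (K : Set (Eucl n)) U)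
    {β : Set (Eucl n)} (hβ : MeasurableSet β) (hβU : β ⊆ U) : Φ K β = 0 := by
  -- for `n = 0` there are no points far away, but every body is the whole space
  rcases subsingleton_or_nontrivial (Eucl n) with hs | hs
  · obtain ⟨x, hx⟩ := K.nonempty
    have : β = ∅ := Set.eq_empty_of_forall_notMem fun y hy =>
      Set.disjoint_left.1 hKU hx (Subsingleton.elim y x ▸ hβU hy)
    rw [this, VectorMeasure.empty]
  obtain ⟨R, hR, hUR⟩ := hUb.subset_ball_lt 0 0
  -- the points `y k` lie outside `U`, and their distances are at least the diameter of `ball 0 R`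
  obtain ⟨v, hv⟩ := exists_norm_eq (Eucl n) (by positivity : 0 ≤ 2 * R)
  let y : ℕ → Eucl n := fun k => ((k : ℝ) + 1) • v
  have hyU : ∀ k, y k ∉ U := by
    intro k hk
    have h1 := mem_ball_zero_iff.1 (hUR hk)
    rw [norm_smul, hv, Real.norm_of_nonneg (by positivity)] at h1
    nlinarith [(Nat.cast_nonneg k : (0 : ℝ) ≤ k)]
  let S : ℕ → Set (Eucl n) := fun k => (fun z => z + y k) ⁻¹' β
  have hSm : ∀ k, MeasurableSet (S k) := fun k => (measurable_add_const (y k)) hβ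
  have hSd : Pairwise (Function.onFun Disjoint S) := by
    intro j k hjk
    refine Set.disjoint_left.2 fun z hzj hzk => ?_
    have h1 : ‖z + y j‖ < R := mem_ball_zero_iff.1 (hUR (hβU hzj))
    have h2 : ‖z + y k‖ < R := mem_ball_zero_iff.1 (hUR (hβU hzk))
    have h3 : ‖y j - y k‖ < 2 * R := by
      have h4 := norm_sub_le (z + y j) (z + y k)
      rw [add_sub_add_left_eq_sub] at h4
      linarith
    have h5 : y j - y k = ((j : ℝ) - k) • v := by
      simp only [y, ← sub_smul]; ring_nf
    have h6 : (1 : ℝ) ≤ |(j : ℝ) - k| := by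
      have : (1 : ℤ) ≤ |(j : ℤ) - k| := Int.one_le_abs (sub_ne_zero.2 (by exact_mod_cast hjk))
      exact_mod_cast this
    rw [h5, norm_smul, hv, Real.norm_eq_abs] at h3
    nlinarith
  have hconst : ∀ k, Φ 0 (S k) = Φ K β := by
    intro k
    have himage : (fun z => z + y k) '' S k = β :=
      Set.image_preimage_eq _ (Homeomorph.addRight (y k)).surjective
    rw [← hΦ.translation 0 (y k) (S k) (hSm k), himage]
    refine hΦ.locality _ _ U hU ?_ β hβ hβU
    rw [hKU.inter_eq]
    refine Set.eq_empty_of_forall_notMem ?_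
    rintro z ⟨⟨w, hw, rfl⟩, hz⟩
    have hw0 : w = 0 := hw
    subst hw0
    exact hyU k (by simpa using hz)
  have hsum := ((Φ 0).m_iUnion hSm hSd).summable
  simp only [hconst] at hsum
  exact (summable_const_iff _).1 hsum

/-- The measure `Φ K` is concentrated on `K`. -/
theorem variation_compl_eq_zero (K : ConvexBody (Eucl n)) :
    (Φ K).variation (K : Set (Eucl n))ᶜ = 0 := by
  have hsub : (K : Set (Eucl n))ᶜ ⊆ ⋃ k : ℕ, (K : Set (Eucl n))ᶜ ∩ Metric.ball 0 k := by
    rw [← Set.inter_iUnion, Metric.iUnion_ball_nat, Set.inter_univ]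
  refine measure_mono_null hsub (measure_iUnion_null fun k => ?_)
  have hU : IsOpen ((K : Set (Eucl n))ᶜ ∩ Metric.ball 0 k) :=
    K.isClosed.isOpen_compl.inter Metric.isOpen_ball
  rw [VectorMeasure.variation_apply_eq_zero hU.measurableSet]
  intro t ht htm
  exact hΦ.apply_eq_zero_of_disjoint K hU (Metric.isBounded_ball.subset Set.inter_subset_right)
    (disjoint_compl_right.mono_right Set.inter_subset_left) htm ht

theorem integral_congr_of_eqOn (K : ConvexBody (Eucl n)) {f g : Eucl n → ℂ}
    (h : Set.EqOn f g K) : integral (Φ K) f = integral (Φ K) g := by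
  refine VectorMeasure.integral_congr_ae ?_
  filter_upwards [measure_eq_zero_iff_ae_notMem.1 (hΦ.variation_compl_eq_zero K)] with x hx
  exact h (Set.notMem_compl_iff.1 hx)

/-- If `f` is supported in a ball about `x`, then `Φ K f` only depends on the part of `K` in that
ball, which can be translated to the origin. -/
theorem integral_eq_zero_or_exists_translate (K : ConvexBody (Eucl n)) (x : Eucl n) {r : ℝ}
    (f : C₀(Eucl n, ℂ)) (hf : ∀ y ∉ Metric.ball x r, f y = 0) :
    integral (Φ K) f = 0 ∨ ∃ L : ConvexBody (Eucl n), (L : Set (Eucl n)) ⊆ Metric.closedBall 0 r ∧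
      integral (Φ K) f = integral (Φ L) (translateFun x f) := by
  rcases Set.eq_empty_or_nonempty ((K : Set (Eucl n)) ∩ Metric.closedBall x r) with he | hne
  · left
    refine integral_eq_zero_of_variation_eq_zero _ (U := Metric.ball x r) ?_ hf
    refine measure_mono_null (Set.subset_compl_iff_disjoint_right.2 ?_)
      (hΦ.variation_compl_eq_zero K)
    exact ((Set.disjoint_iff_inter_eq_empty.2 he).mono_right Metric.ball_subset_closedBall).symm
  · right
    let K' : ConvexBody (Eucl n) := ⟨(K : Set (Eucl n)) ∩ Metric.closedBall x r,
      K.convex.inter (convex_closedBall x r), K.isCompact.inter_right Metric.isClosed_closedBall,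
      hne⟩
    have hK' : translate (translate K' (-x)) x = K' := by
      refine ConvexBody.ext ?_
      rw [coe_translate, coe_translate, Set.image_image]
      simp
    refine ⟨translate K' (-x), ?_, ?_⟩
    · rintro _ ⟨y, hy, rfl⟩
      have h1 : y ∈ Metric.closedBall x r := hy.2
      rw [mem_closedBall_zero_iff]
      change ‖y + -x‖ ≤ r
      rwa [← sub_eq_add_neg, ← mem_closedBall_iff_norm]
    · have ht : integral (Φ K') f = integral (Φ (translate K' (-x))) (translateFun x f) := by
        conv_lhs => rw [← hK', hΦ.integral_translate]
        rfl
      rw [← ht]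
      refine integral_eq_of_eqOn (Φ K) (Φ K') measurableSet_ball (fun β hβ hβU => ?_) f.toBCF hf
      refine hΦ.locality K K' _ Metric.isOpen_ball ?_ β hβ hβU
      change _ = ((K : Set (Eucl n)) ∩ Metric.closedBall x r) ∩ Metric.ball x r
      rw [Set.inter_assoc, Set.inter_eq_right.2 Metric.ball_subset_closedBall]

end IsLocalCovariant

theorem enorm_integral_le_gauge (Φ : Curv n) {B : Set (Eucl n)} {F : Set C₀(Eucl n, ℂ)}
    {K : ConvexBody (Eucl n)} (hK : (K : Set (Eucl n)) ⊆ B) {f : C₀(Eucl n, ℂ)} (hf : f ∈ F) :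
    ‖integral (Φ.1 K) f‖ₑ ≤ gauge B F Φ :=
  le_iSup₂_of_le K hK (le_iSup₂_of_le (f := fun f (_ : f ∈ F) => ‖integral (Φ.1 K) f‖ₑ) f hf le_rfl)

theorem sum_zeroAtInfty_apply {ι : Type*} (s : Finset ι) (g : ι → C₀(Eucl n, ℂ)) (y : Eucl n) :
    (∑ j ∈ s, g j) y = ∑ j ∈ s, g j y := by
  induction s using Finset.cons_induction with
  | empty => simp
  | cons a s ha ih => rw [Finset.sum_cons, Finset.sum_cons, ZeroAtInftyContinuousMap.add_apply, ih]

/-- A partition of unity on a ball by functions that are supported in balls of radius `r`. -/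
theorem exists_partition (R : ℝ) {r : ℝ} (hr : 0 < r) :
    ∃ (N : ℕ) (x : Fin N → Eucl n) (χ : Fin N → (Eucl n →ᵇ ℂ)),
      (∀ j, ∀ y ∉ Metric.ball (x j) r, χ j y = 0) ∧
        ∀ y ∈ Metric.closedBall 0 R, ∑ j, χ j y = 1 := by
  obtain ⟨t, -, htf, ht⟩ := (isCompact_closedBall (0 : Eucl n) R).finite_cover_balls hr
  lift t to Finset (Eucl n) using htf
  let x : Fin t.card → Eucl n := fun j => t.equivFin.symm j
  have hcover : Metric.closedBall (0 : Eucl n) R ⊆ ⋃ j, Metric.ball (x j) r := by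
    intro z hz
    obtain ⟨c, hc, hzc⟩ := Set.mem_iUnion₂.1 (ht hz)
    refine Set.mem_iUnion.2 ⟨t.equivFin ⟨c, hc⟩, ?_⟩
    simpa [x] using hzc
  obtain ⟨φ, hφsupp, hφsum, hφ01, -⟩ := exists_continuous_sum_one_of_isOpen_isCompact
    (fun j => Metric.isOpen_ball) (isCompact_closedBall (0 : Eucl n) R) hcover
  refine ⟨t.card, x, fun j => BoundedContinuousFunction.ofNormedAddCommGroup
    (fun y => (φ j y : ℂ)) (by fun_prop) 1 fun y => ?_, fun j y hy => ?_, fun y hy => ?_⟩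
  · rw [Complex.norm_real, Real.norm_of_nonneg (hφ01 j y).1]
    exact (hφ01 j y).2
  · change ((φ j y : ℝ) : ℂ) = 0
    rw [image_eq_zero_of_notMem_tsupport fun h => hy (hφsupp j h), Complex.ofReal_zero]
  · change ∑ j, ((φ j y : ℝ) : ℂ) = 1
    have h := hφsum hy
    rw [Finset.sum_apply, Pi.one_apply] at h
    rw [← Complex.ofReal_sum, h, Complex.ofReal_one]

/-- The bodies inside a small ball control the bodies inside a large ball: a partition of unity
splits `Φ K f` into pieces, each of which is seen by a small part of `K`. -/
theorem exists_gauge_closedBall_le {B : Set (Eucl n)} (h0 : (0 : Eucl n) ∈ interior B) (R : ℝ)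
    {F : Set C₀(Eucl n, ℂ)} (hF : IsCompact F) :
    ∃ (N : ℕ) (F' : Set C₀(Eucl n, ℂ)), IsCompact F' ∧
      ∀ Φ : Curv n, gauge (Metric.closedBall 0 R) F Φ ≤ N * gauge B F' Φ := by
  obtain ⟨r, hr, hrB⟩ := Metric.nhds_basis_closedBall.mem_iff.1 (mem_interior_iff_mem_nhds.1 h0)
  obtain ⟨N, x, χ, hχ0, hχ1⟩ := exists_partition (n := n) R hr
  let T : Fin N → (C₀(Eucl n, ℂ) →L[ℂ] C₀(Eucl n, ℂ)) :=
    fun j => (translateFun (x j)).comp (bcfMul (χ j))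
  refine ⟨N, ⋃ j, T j '' F, isCompact_iUnion fun j => hF.image (T j).continuous, fun Φ => ?_⟩
  have hΦ := Φ.2.isLocalCovariant
  refine iSup₂_le fun K hK => iSup₂_le fun f hf => ?_
  have hsum : integral (Φ.1 K) f = ∑ j, integral (Φ.1 K) (bcfMul (χ j) f) := by
    have h1 : integral (Φ.1 K) f = functional (Φ.1 K) (∑ j, bcfMul (χ j) f) := by
      refine hΦ.integral_congr_of_eqOn K fun y hy => ?_
      rw [sum_zeroAtInfty_apply]
      simp only [bcfMul_apply]
      rw [← Finset.sum_mul, hχ1 y (hK hy), one_mul]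
    rw [h1, map_sum]
    rfl
  have hpiece : ∀ j, ‖integral (Φ.1 K) (bcfMul (χ j) f)‖ₑ ≤ gauge B (⋃ j, T j '' F) Φ := by
    intro j
    have hz : ∀ y ∉ Metric.ball (x j) r, bcfMul (χ j) f y = 0 := fun y hy => by
      rw [bcfMul_apply, hχ0 j y hy, zero_mul]
    rcases hΦ.integral_eq_zero_or_exists_translate K (x j) (bcfMul (χ j) f) hz with h | ⟨L, hL, h⟩
    · rw [h, enorm_zero]; exact zero_le
    · have hT : translateFun (x j) (bcfMul (χ j) f) ∈ ⋃ j, T j '' F := 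
          Set.mem_iUnion.2 ⟨j, Set.mem_image_of_mem (T j) hf⟩
      rw [h]
      exact enorm_integral_le_gauge Φ (hL.trans hrB) hT
  calc ‖integral (Φ.1 K) f‖ₑ ≤ ∑ j, ‖integral (Φ.1 K) (bcfMul (χ j) f)‖ₑ := by
        rw [hsum]; exact enorm_sum_le _ _
    _ ≤ ∑ _j : Fin N, gauge B (⋃ j, T j '' F) Φ := Finset.sum_le_sum fun j _ => hpiece j
    _ = N * gauge B (⋃ j, T j '' F) Φ := by simp

/-! ### Compactness and finiteness -/

/-- The nonempty compact set underlying a convex body. -/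
def toNonemptyCompacts (K : ConvexBody (Eucl n)) : TopologicalSpace.NonemptyCompacts (Eucl n) :=
  ⟨⟨K, K.isCompact⟩, K.nonempty⟩

theorem isometry_toNonemptyCompacts : Isometry (toNonemptyCompacts (n := n)) :=
  fun K L => ConvexBody.hausdorffEDist_coe K L

theorem isClosed_convex_nonemptyCompacts :
    IsClosed {L : TopologicalSpace.NonemptyCompacts (Eucl n) | Convex ℝ (L : Set (Eucl n))} := by
  have hc : ∀ a b : ℝ, Continuous fun p : Eucl n × Eucl n => a • p.1 + b • p.2 :=
    fun a b => by fun_prop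
  -- `L` is convex if and only if `L ∪ (a L + b L) = L` whenever `a, b ≥ 0` and `a + b = 1`, and
  -- both sides of this equation depend continuously on `L`
  have h : {L : TopologicalSpace.NonemptyCompacts (Eucl n) | Convex ℝ (L : Set (Eucl n))} =
      ⋂ (a : ℝ) (b : ℝ) (_ : 0 ≤ a) (_ : 0 ≤ b) (_ : a + b = 1),
        {L | (L ×ˢ L).map (fun p : Eucl n × Eucl n => a • p.1 + b • p.2) (hc a b) ⊔ L = L} := by
    ext L
    simp only [Set.mem_iInter, Set.mem_ofPred_eq, sup_eq_right]
    constructor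
    · rintro hL a b ha hb hab _ ⟨⟨p, q⟩, hpq, rfl⟩
      exact hL hpq.1 hpq.2 ha hb hab
    · intro hL p hp q hq a b ha hb hab
      exact hL a b ha hb hab ⟨(p, q), ⟨hp, hq⟩, rfl⟩
  rw [h]
  refine isClosed_iInter fun a => isClosed_iInter fun b => isClosed_iInter fun _ =>
    isClosed_iInter fun _ => isClosed_iInter fun _ => isClosed_eq ?_ continuous_id
  exact (((hc a b).nonemptyCompacts_map).comp
    (TopologicalSpace.NonemptyCompacts.continuous_prod.comp
      (continuous_id.prodMk continuous_id))).sup continuous_id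

/-- Blaschke selection theorem: the convex bodies inside a compact set form a compact set. -/
theorem isCompact_convexBody_subset {S : Set (Eucl n)} (hS : IsCompact S) :
    IsCompact {K : ConvexBody (Eucl n) | (K : Set (Eucl n)) ⊆ S} := by
  rw [isometry_toNonemptyCompacts.isUniformInducing.isInducing.isCompact_iff]
  have h : toNonemptyCompacts '' {K : ConvexBody (Eucl n) | (K : Set (Eucl n)) ⊆ S} =
      {L : TopologicalSpace.NonemptyCompacts (Eucl n) | (L : Set (Eucl n)) ⊆ S} ∩
        {L | Convex ℝ (L : Set (Eucl n))} := by
    ext L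
    constructor
    · rintro ⟨K, hK, rfl⟩
      exact ⟨hK, K.convex⟩
    · rintro ⟨hL, hLc⟩
      exact ⟨⟨L, hLc, L.isCompact, L.nonempty⟩, hL, rfl⟩
  rw [h]
  exact (TopologicalSpace.NonemptyCompacts.isCompact_subsets_of_isCompact hS).inter_right
    isClosed_convex_nonemptyCompacts

/-- The norms `‖Φ K‖` are bounded over `K ⊆ B`. By the uniform boundedness principle it is enough
to bound `Φ K f` for each fixed `f`, where the continuity of `Φ` and the compactness of the set of
bodies apply. -/
theorem exists_norm_functional_le (Φ : Curv n) {B : Set (Eucl n)} (hB : Bornology.IsBounded B) :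
    ∃ C : ℝ, ∀ K : ConvexBody (Eucl n), (K : Set (Eucl n)) ⊆ B → ‖functional (Φ.1 K)‖ ≤ C := by
  obtain ⟨R, hR⟩ := hB.subset_closedBall 0
  obtain ⟨C, hC⟩ := banach_steinhaus
    (g := fun K : {K : ConvexBody (Eucl n) // (K : Set (Eucl n)) ⊆ B} => functional (Φ.1 K.1))
    fun f => by
      have hcont : Continuous fun K : ConvexBody (Eucl n) => integral (Φ.1 K) f := by
        refine SeqContinuous.continuous fun K L h => ?_
        exact Φ.2.continuity K L h f.toBCF
      obtain ⟨C, hC⟩ := (isCompact_convexBody_subset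
        (isCompact_closedBall (0 : Eucl n) R)).exists_bound_of_continuousOn hcont.continuousOn
      exact ⟨C, fun K => hC K.1 (K.2.trans hR)⟩
  exact ⟨C, fun K hK => hC ⟨K, hK⟩⟩

theorem variation_univ_le_of_norm_functional_le (μ : M n) {C : ℝ} (hC : ‖functional μ‖ ≤ C) :
    μ.variation Set.univ ≤ ENNReal.ofReal C := by
  refine variation_univ_le μ fun f hf => ?_
  rw [← ofReal_norm]
  refine ENNReal.ofReal_le_ofReal ?_
  exact ((functional μ).le_opNorm f).trans
    ((mul_le_of_le_one_right (norm_nonneg _) hf).trans hC)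

theorem variationGauge_ne_top (Φ : Curv n) {B : Set (Eucl n)} (hB : Bornology.IsBounded B) :
    variationGauge B Φ ≠ ∞ := by
  obtain ⟨C, hC⟩ := exists_norm_functional_le Φ hB
  refine ne_top_of_le_ne_top ENNReal.ofReal_ne_top (b := ENNReal.ofReal C) ?_
  exact iSup₂_le fun K hK => variation_univ_le_of_norm_functional_le _ (hC K hK)

theorem exists_gauge_le {F : Set C₀(Eucl n, ℂ)} (hF : IsCompact F) :
    ∃ c : ℝ≥0, ∀ (B : Set (Eucl n)) (Φ : Curv n), gauge B F Φ ≤ variationGauge B Φ * c := by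
  obtain ⟨c, hc⟩ := hF.isBounded.exists_norm_le
  refine ⟨c.toNNReal, fun B Φ => iSup₂_le fun K hK => iSup₂_le fun f hf => ?_⟩
  refine (enorm_integral_le_variation_mul _ f).trans (mul_le_mul' ?_ ?_)
  · exact le_iSup₂_of_le (f := fun (K : ConvexBody (Eucl n)) (_ : (K : Set (Eucl n)) ⊆ B) =>
      (Φ.1 K).variation Set.univ) K hK le_rfl
  · rw [← ofReal_norm]
    exact ENNReal.ofReal_le_ofReal (hc f hf)

theorem gauge_ne_top (Φ : Curv n) {B : Set (Eucl n)} (hB : Bornology.IsBounded B)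
    {F : Set C₀(Eucl n, ℂ)} (hF : IsCompact F) : gauge B F Φ ≠ ∞ := by
  obtain ⟨c, hc⟩ := exists_gauge_le hF
  exact ne_top_of_le_ne_top
    (ENNReal.mul_ne_top (variationGauge_ne_top Φ hB) ENNReal.coe_ne_top) (hc B Φ)

/-! ### The seminorms and the uniform structure -/

theorem integral_coe_sub (Φ Ψ : Curv n) (K : ConvexBody (Eucl n)) (f : C₀(Eucl n, ℂ)) :
    integral ((Φ - Ψ).1 K) f = integral (Φ.1 K) f - integral (Ψ.1 K) f :=
  integral_sub_measure (Φ.1 K) (Ψ.1 K) f.toBCF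

theorem gauge_le_iff {B : Set (Eucl n)} {F : Set C₀(Eucl n, ℂ)} {Φ : Curv n} {a : ℝ≥0∞} :
    gauge B F Φ ≤ a ↔ ∀ K : ConvexBody (Eucl n), (K : Set (Eucl n)) ⊆ B → ∀ f ∈ F,
      ‖integral (Φ.1 K) f‖ₑ ≤ a := by
  simp only [gauge, iSup_le_iff]

theorem variationGauge_le_iff {B : Set (Eucl n)} {Φ : Curv n} {a : ℝ≥0∞} :
    variationGauge B Φ ≤ a ↔ ∀ K : ConvexBody (Eucl n), (K : Set (Eucl n)) ⊆ B →
      (Φ.1 K).variation Set.univ ≤ a := by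
  simp only [variationGauge, iSup_le_iff]

theorem gauge_add_le (B : Set (Eucl n)) (F : Set C₀(Eucl n, ℂ)) (Φ Ψ : Curv n) :
    gauge B F (Φ + Ψ) ≤ gauge B F Φ + gauge B F Ψ := by
  refine gauge_le_iff.2 fun K hK f hf => ?_
  have h : integral ((Φ + Ψ).1 K) f = integral (Φ.1 K) f + integral (Ψ.1 K) f :=
    integral_add_measure (Φ.1 K) (Ψ.1 K) f.toBCF
  rw [h]
  exact (enorm_add_le _ _).trans
    (add_le_add (enorm_integral_le_gauge Φ hK hf) (enorm_integral_le_gauge Ψ hK hf))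

theorem gauge_smul (B : Set (Eucl n)) (F : Set C₀(Eucl n, ℂ)) (c : ℂ) (Φ : Curv n) :
    gauge B F (c • Φ) = ‖c‖ₑ * gauge B F Φ := by
  have h : ∀ (K : ConvexBody (Eucl n)) (f : C₀(Eucl n, ℂ)),
      ‖integral ((c • Φ).1 K) f‖ₑ = ‖c‖ₑ * ‖integral (Φ.1 K) f‖ₑ := fun K f => by
    rw [← enorm_mul]
    exact congrArg _ (integral_smul_measure c (Φ.1 K) f.toBCF)
  simp only [gauge, h, ENNReal.mul_iSup]

theorem variationGauge_add_le (B : Set (Eucl n)) (Φ Ψ : Curv n) :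
    variationGauge B (Φ + Ψ) ≤ variationGauge B Φ + variationGauge B Ψ := by
  refine variationGauge_le_iff.2 fun K hK => ?_
  refine (Measure.le_iff'.1 (VectorMeasure.variation_add_le (μ := Φ.1 K) (ν := Ψ.1 K)) _).trans ?_
  exact add_le_add (variationGauge_le_iff.1 le_rfl K hK) (variationGauge_le_iff.1 le_rfl K hK)

theorem variationGauge_smul (B : Set (Eucl n)) (c : ℂ) (Φ : Curv n) :
    variationGauge B (c • Φ) = ‖c‖ₑ * variationGauge B Φ := by
  have h : ∀ K : ConvexBody (Eucl n),
      ((c • Φ).1 K).variation Set.univ = ‖c‖ₑ * (Φ.1 K).variation Set.univ := fun K => by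
    change (c • Φ.1 K).variation Set.univ = _
    rw [VectorMeasure.variation_smul]
    rfl
  simp only [variationGauge, h, ENNReal.mul_iSup]

/-- The seminorm `p_{B,F}`, for bounded `B` and compact `F`. -/
noncomputable def gaugeSeminorm {B : Set (Eucl n)} (hB : Bornology.IsBounded B)
    {F : Set C₀(Eucl n, ℂ)} (hF : IsCompact F) : Seminorm ℂ (Curv n) :=
  Seminorm.of (fun Φ => (gauge B F Φ).toReal)
    (fun Φ Ψ => by
      rw [← ENNReal.toReal_add (gauge_ne_top Φ hB hF) (gauge_ne_top Ψ hB hF)]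
      exact ENNReal.toReal_mono
        (ENNReal.add_ne_top.2 ⟨gauge_ne_top Φ hB hF, gauge_ne_top Ψ hB hF⟩) (gauge_add_le B F Φ Ψ))
    fun c Φ => by rw [gauge_smul, ENNReal.toReal_mul, toReal_enorm]

theorem ofReal_gaugeSeminorm {B : Set (Eucl n)} (hB : Bornology.IsBounded B)
    {F : Set C₀(Eucl n, ℂ)} (hF : IsCompact F) (Φ : Curv n) :
    ENNReal.ofReal (gaugeSeminorm hB hF Φ) = gauge B F Φ :=
  ENNReal.ofReal_toReal (gauge_ne_top Φ hB hF)

/-- The seminorm `‖·‖_B`, for bounded `B`. -/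
noncomputable def variationSeminorm {B : Set (Eucl n)} (hB : Bornology.IsBounded B) :
    Seminorm ℂ (Curv n) :=
  Seminorm.of (fun Φ => (variationGauge B Φ).toReal)
    (fun Φ Ψ => by
      rw [← ENNReal.toReal_add (variationGauge_ne_top Φ hB) (variationGauge_ne_top Ψ hB)]
      exact ENNReal.toReal_mono
        (ENNReal.add_ne_top.2 ⟨variationGauge_ne_top Φ hB, variationGauge_ne_top Ψ hB⟩)
        (variationGauge_add_le B Φ Ψ))
    fun c Φ => by rw [variationGauge_smul, ENNReal.toReal_mul, toReal_enorm]

theorem ofReal_variationSeminorm {B : Set (Eucl n)} (hB : Bornology.IsBounded B) (Φ : Curv n) :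
    ENNReal.ofReal (variationSeminorm hB Φ) = variationGauge B Φ :=
  ENNReal.ofReal_toReal (variationGauge_ne_top Φ hB)

theorem gaugeEMetric_toUniformSpace {B : Set (Eucl n)} (hB : Bornology.IsBounded B)
    {F : Set C₀(Eucl n, ℂ)} (hF : IsCompact F) :
    (gaugeEMetric B F).toUniformSpace =
      (gaugeSeminorm hB hF).toSeminormedAddCommGroup.toUniformSpace := by
  have h : gaugeEMetric B F =
      (gaugeSeminorm hB hF).toSeminormedAddCommGroup.toPseudoEMetricSpace := by
    refine PseudoEMetricSpace.ext ?_
    ext Φ Ψ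
    let _ := (gaugeSeminorm hB hF).toSeminormedAddCommGroup
    change gauge B F (Φ - Ψ) = edist Φ Ψ
    rw [edist_dist, dist_eq_norm]
    exact (ofReal_gaugeSeminorm hB hF (Φ - Ψ)).symm
  exact congrArg (fun e : PseudoEMetricSpace (Curv n) => e.toUniformSpace) h

theorem compactConvergence_eq {B : Set (Eucl n)} (hB : Bornology.IsBounded B) :
    compactConvergence B = ⨅ F : {F : Set C₀(Eucl n, ℂ) // IsCompact F},
      (gaugeSeminorm hB F.2).toSeminormedAddCommGroup.toUniformSpace :=
  iInf_congr fun F => gaugeEMetric_toUniformSpace hB F.2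

theorem isUniformAddGroup_compactConvergence {B : Set (Eucl n)} (hB : Bornology.IsBounded B) :
    @IsUniformAddGroup (Curv n) (compactConvergence B) _ := by
  rw [compactConvergence_eq hB]
  exact isUniformAddGroup_iInf fun F =>
    let _ := (gaugeSeminorm hB F.2).toSeminormedAddCommGroup
    inferInstance

theorem subset_closedBall (K : ConvexBody (Eucl n)) :
    ∃ R, (K : Set (Eucl n)) ⊆ Metric.closedBall 0 R :=
  K.isBounded.subset_closedBall 0

/-- The seminorms `p_{B,F}` separate the points of `Curv n`. -/
theorem eq_zero_of_gauge_eq_zero {B : Set (Eucl n)} (h0 : (0 : Eucl n) ∈ interior B) {Φ : Curv n}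
    (h : ∀ F : Set C₀(Eucl n, ℂ), IsCompact F → gauge B F Φ = 0) : Φ = 0 := by
  refine Subtype.ext (funext fun K => eq_zero_of_forall_integral_eq_zero _ fun f => ?_)
  obtain ⟨R, hR⟩ := subset_closedBall K
  obtain ⟨N, F', hF', hle⟩ := exists_gauge_closedBall_le h0 R (isCompact_singleton (x := f))
  have h1 := (enorm_integral_le_gauge Φ hR (Set.mem_singleton f)).trans (hle Φ)
  rw [h F' hF', mul_zero] at h1
  exact enorm_eq_zero.1 (le_antisymm h1 zero_le)

/-! ### Completeness -/

theorem exists_zeroAtInfty_eqOn (f : Eucl n →ᵇ ℂ) {S : Set (Eucl n)} (hS : IsCompact S) :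
    ∃ g : C₀(Eucl n, ℂ), Set.EqOn f g S := by
  obtain ⟨φ, hφ1, -, hφs, -⟩ := exists_continuous_one_zero_of_isCompact hS
    (isClosed_empty (X := Eucl n)) (Set.disjoint_empty S)
  have hs : HasCompactSupport fun x => (φ x : ℂ) * f x :=
    (hφs.comp_left (g := fun r : ℝ => (r : ℂ)) Complex.ofReal_zero).mul_right
  have hc : Continuous fun x => (φ x : ℂ) * f x := by fun_prop
  refine ⟨⟨⟨_, hc⟩, hs.is_zero_at_infty⟩, fun x hx => ?_⟩
  change f x = (φ x : ℂ) * f x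
  rw [hφ1 hx]; simp

theorem eventually_subset_closedBall {K : ℕ → ConvexBody (Eucl n)} {L : ConvexBody (Eucl n)}
    (h : Tendsto K atTop (𝓝 L)) :
    ∃ R, (L : Set (Eucl n)) ⊆ Metric.closedBall 0 R ∧
      ∀ᶠ i in atTop, (K i : Set (Eucl n)) ⊆ Metric.closedBall 0 R := by
  obtain ⟨R, hR⟩ := subset_closedBall L
  refine ⟨R + 1, hR.trans (Metric.closedBall_subset_closedBall (by linarith)), ?_⟩
  filter_upwards [Metric.tendsto_nhds.1 h 1 one_pos] with i hi x hx
  obtain ⟨y, hy, hxy⟩ := Metric.exists_dist_lt_of_hausdorffDist_lt hx hi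
    ConvexBody.hausdorffEDist_ne_top
  have h1 := mem_closedBall_zero_iff.1 (hR hy)
  rw [mem_closedBall_zero_iff]
  have h2 := norm_le_norm_add_norm_sub' x y
  rw [← dist_eq_norm] at h2
  linarith

variable {B : Set (Eucl n)}

/-- A filter that is Cauchy for the seminorms `p_{B,F}` is Cauchy for the analogous seminorms
of every ball. -/
theorem exists_mem_gauge_closedBall_le (h0 : (0 : Eucl n) ∈ interior B) {l : Filter (Curv n)}
    (hl : ∀ F : Set C₀(Eucl n, ℂ), IsCompact F → ∀ ε : ℝ≥0∞, 0 < ε →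
      ∃ t ∈ l, ∀ Φ ∈ t, ∀ Ψ ∈ t, gauge B F (Φ - Ψ) < ε)
    (R : ℝ) {F : Set C₀(Eucl n, ℂ)} (hF : IsCompact F) {ε : ℝ≥0∞} (hε : 0 < ε) :
    ∃ t ∈ l, ∀ Φ ∈ t, ∀ Ψ ∈ t, gauge (Metric.closedBall 0 R) F (Φ - Ψ) ≤ ε := by
  obtain ⟨N, F', hF', hle⟩ := exists_gauge_closedBall_le h0 R hF
  obtain ⟨t, ht, h⟩ := hl F' hF' (ε / (N + 1)) (ENNReal.div_pos hε.ne' (by simp))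
  refine ⟨t, ht, fun Φ hΦ Ψ hΨ => ?_⟩
  calc gauge (Metric.closedBall 0 R) F (Φ - Ψ) ≤ N * gauge B F' (Φ - Ψ) := hle _
    _ ≤ (N + 1) * (ε / (N + 1)) := mul_le_mul' le_self_add (h Φ hΦ Ψ hΨ).le
    _ ≤ ε := ENNReal.mul_div_le

/-- Compact convergence of functionals, each of which is continuous, to a linear map: the limit is
continuous because a null sequence together with `0` is a compact set. -/
theorem continuous_of_compact_approx (Λ : C₀(Eucl n, ℂ) →ₗ[ℂ] ℂ)
    (h : ∀ F : Set C₀(Eucl n, ℂ), IsCompact F → ∀ ε : ℝ, 0 < ε →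
      ∃ T : C₀(Eucl n, ℂ) →L[ℂ] ℂ, ∀ f ∈ F, ‖T f - Λ f‖ ≤ ε) : Continuous Λ := by
  refine continuous_of_continuousAt_zero Λ ?_
  rw [ContinuousAt, map_zero]
  refine tendsto_of_seq_tendsto fun f hf => Metric.tendsto_nhds.2 fun ε hε => ?_
  obtain ⟨T, hT⟩ := h _ hf.isCompact_insert_range (ε / 2) (half_pos hε)
  have hTf : Tendsto (fun k => T (f k)) atTop (𝓝 0) := by
    rw [← map_zero T]
    exact (T.continuous.tendsto 0).comp hf
  filter_upwards [Metric.tendsto_nhds.1 hTf (ε / 2) (half_pos hε)] with k hk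
  have h1 := hT (f k) (Set.mem_insert_of_mem _ ⟨k, rfl⟩)
  rw [dist_zero_right] at hk ⊢
  change ‖Λ (f k)‖ < ε
  have h2 := norm_sub_norm_le (Λ (f k)) (T (f k))
  rw [norm_sub_rev] at h2
  linarith

/-- A filter that is Cauchy for all `p_{B,F}` converges pointwise to a curvature measure. Locality
and translation covariance pass to the limit by testing against `C₀`. The continuity on `C₀` follows
from uniform convergence on the bodies inside a ball, and extends to bounded functions since the
limit measures are concentrated on the bodies. -/
theorem exists_tendsto_integral (h0 : (0 : Eucl n) ∈ interior B) {l : Filter (Curv n)} [l.NeBot]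
    (hl : ∀ F : Set C₀(Eucl n, ℂ), IsCompact F → ∀ ε : ℝ≥0∞, 0 < ε →
      ∃ t ∈ l, ∀ Φ ∈ t, ∀ Ψ ∈ t, gauge B F (Φ - Ψ) < ε) :
    ∃ Θ : Curv n, ∀ (K : ConvexBody (Eucl n)) (f : C₀(Eucl n, ℂ)),
      Tendsto (fun Φ : Curv n => integral (Φ.1 K) f) l (𝓝 (integral (Θ.1 K) f)) := by
  have hlim : ∀ (K : ConvexBody (Eucl n)) (f : C₀(Eucl n, ℂ)),
      ∃ z, Tendsto (fun Φ : Curv n => integral (Φ.1 K) f) l (𝓝 z) := by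
    intro K f
    obtain ⟨R, hR⟩ := subset_closedBall K
    refine cauchy_map_iff_exists_tendsto.1
      (EMetric.cauchy_iff.2 ⟨NeBot.ne inferInstance, fun ε hε => ?_⟩)
    obtain ⟨δ, hδ, hδε⟩ := exists_between hε
    obtain ⟨t, ht, h⟩ := exists_mem_gauge_closedBall_le h0 hl R (isCompact_singleton (x := f)) hδ
    refine ⟨_, image_mem_map ht, ?_⟩
    rintro _ ⟨Φ, hΦ, rfl⟩ _ ⟨Ψ, hΨ, rfl⟩
    rw [edist_eq_enorm_sub, ← integral_coe_sub]
    exact ((enorm_integral_le_gauge (Φ - Ψ) hR (Set.mem_singleton f)).trans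
      (h Φ hΦ Ψ hΨ)).trans_lt hδε
  choose L hL using hlim
  have hunif : ∀ (R : ℝ) (F : Set C₀(Eucl n, ℂ)), IsCompact F → ∀ ε : ℝ, 0 < ε → ∃ Φ : Curv n,
      ∀ K : ConvexBody (Eucl n), (K : Set (Eucl n)) ⊆ Metric.closedBall 0 R → ∀ f ∈ F,
        ‖integral (Φ.1 K) f - L K f‖ ≤ ε := by
    intro R F hF ε hε
    obtain ⟨t, ht, h⟩ := exists_mem_gauge_closedBall_le h0 hl R hF (ENNReal.ofReal_pos.2 hε)
    obtain ⟨Φ, hΦ⟩ := l.nonempty_of_mem ht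
    refine ⟨Φ, fun K hK f hf => le_of_tendsto ((hL K f).const_sub _).norm ?_⟩
    filter_upwards [ht] with Ψ hΨ
    have h1 := (enorm_integral_le_gauge (Φ - Ψ) hK hf).trans (h Φ hΦ Ψ hΨ)
    rw [integral_coe_sub, ← ofReal_norm] at h1
    exact (ENNReal.ofReal_le_ofReal_iff hε.le).1 h1
  have hriesz : ∀ K : ConvexBody (Eucl n), ∃ μ : M n, ∀ f : C₀(Eucl n, ℂ),
      integral μ f = L K f := by
    intro K
    obtain ⟨R, hR⟩ := subset_closedBall K
    let Λ : C₀(Eucl n, ℂ) →ₗ[ℂ] ℂ :=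
      { toFun := L K
        map_add' f g := tendsto_nhds_unique (hL K (f + g)) <|
          ((hL K f).add (hL K g)).congr fun Φ => (map_add (functional (Φ.1 K)) f g).symm
        map_smul' c f := tendsto_nhds_unique (hL K (c • f)) <|
          ((hL K f).const_mul c).congr fun Φ => (map_smul (functional (Φ.1 K)) c f).symm }
    have hΛ : Continuous Λ := continuous_of_compact_approx Λ fun F hF ε hε => by
      obtain ⟨Φ, hΦ⟩ := hunif R F hF ε hε
      exact ⟨functional (Φ.1 K), hΦ K hR⟩
    obtain ⟨μ, hμ⟩ := exists_functional_eq ⟨Λ, hΛ⟩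
    exact ⟨μ, fun f => DFunLike.congr_fun hμ f⟩
  choose μ hμ using hriesz
  have hlocal : IsLocalCovariant μ := by
    refine ⟨fun K K' U hU hKK' β hβ hβU => ?_, fun K x β hβ => ?_⟩
    · rw [← sub_eq_zero, ← sub_apply]
      refine apply_eq_zero_of_forall_integral_eq_zero _ hU (fun f hf => ?_) hβ hβU
      have h1 : integral (μ K - μ K') f = integral (μ K) f - integral (μ K') f :=
        integral_sub_measure _ _ f.toBCF
      rw [h1, sub_eq_zero, hμ, hμ]
      refine tendsto_nhds_unique (hL K f) ((hL K' f).congr fun Φ => ?_)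
      exact (integral_eq_of_eqOn _ _ hU.measurableSet
        (fun β hβ hβU => Φ.2.locality K K' U hU hKK' β hβ hβU) f.toBCF hf).symm
    · have h1 : μ (translate K x) = (μ K).map (MeasurableEquiv.addRight x) := by
        rw [← sub_eq_zero]
        refine eq_zero_of_forall_integral_eq_zero _ fun f => ?_
        have h2 : integral (μ (translate K x) - (μ K).map (MeasurableEquiv.addRight x)) f =
            integral (μ (translate K x)) f -
              integral ((μ K).map (MeasurableEquiv.addRight x)) f :=
          integral_sub_measure _ _ f.toBCF
        have h3 : integral ((μ K).map (MeasurableEquiv.addRight x)) f =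
            integral (μ K) (translateFun x f) :=
          VectorMeasure.integral_map_equiv (MeasurableEquiv.addRight x) f
        rw [h2, h3, sub_eq_zero, hμ, hμ]
        refine tendsto_nhds_unique (hL (translate K x) f)
          ((hL K (translateFun x f)).congr fun Φ => ?_)
        exact (Φ.2.isLocalCovariant.integral_translate K x f).symm
      have h4 : MeasurableSet ((fun y => y + x) '' β) :=
        (MeasurableEquiv.addRight x).measurableSet_image.2 hβ
      rw [h1, VectorMeasure.map_apply _ (MeasurableEquiv.addRight x).measurable h4]
      congr 1
      exact Set.preimage_image_eq _ (MeasurableEquiv.addRight x).injective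
  have hcurv : IsCurvatureMeasure μ := by
    refine ⟨hlocal.locality, hlocal.translation, fun K K' hK f => ?_⟩
    obtain ⟨R, hR, hRK⟩ := eventually_subset_closedBall hK
    obtain ⟨g, hg⟩ := exists_zeroAtInfty_eqOn f (isCompact_closedBall (0 : Eucl n) R)
    rw [Metric.tendsto_nhds]
    intro ε hε
    obtain ⟨Φ, hΦ⟩ := hunif R {g} isCompact_singleton (ε / 3) (by positivity)
    have hΦt := Metric.tendsto_nhds.1 (Φ.2.continuity K K' hK g.toBCF) (ε / 3) (by positivity)
    filter_upwards [hRK, hΦt] with i hi hΦi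
    rw [hlocal.integral_congr_of_eqOn (K i) (hg.mono hi),
      hlocal.integral_congr_of_eqOn K' (hg.mono hR), hμ, hμ]
    have h1 := hΦ (K i) hi g rfl
    have h2 := hΦ K' hR g rfl
    rw [← dist_eq_norm] at h1 h2
    have h3 := dist_triangle4_left (integral (Φ.1 (K i)) g) (integral (Φ.1 K') g)
      (L (K i) g) (L K' g)
    have h4 : dist (integral (Φ.1 (K i)) g) (integral (Φ.1 K') g) < ε / 3 := hΦi
    linarith
  exact ⟨⟨μ, hcurv⟩, fun K f => (hμ K f).symm ▸ hL K f⟩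

theorem completeSpace_compactConvergence (h0 : (0 : Eucl n) ∈ interior B) :
    @CompleteSpace (Curv n) (compactConvergence B) := by
  let _ : UniformSpace (Curv n) := compactConvergence B
  refine ⟨fun {l} hl => ?_⟩
  have hne : l.NeBot := hl.1
  have hl' : ∀ F : Set C₀(Eucl n, ℂ), IsCompact F → ∀ ε : ℝ≥0∞, 0 < ε →
      ∃ t ∈ l, ∀ Φ ∈ t, ∀ Ψ ∈ t, gauge B F (Φ - Ψ) < ε := by
    intro F hF ε hε
    have h1 : @Cauchy _ (gaugeEMetric B F).toUniformSpace l :=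
      hl.mono_uniformSpace (iInf_le _ (⟨F, hF⟩ : {F : Set C₀(Eucl n, ℂ) // IsCompact F}))
    exact ((@EMetric.cauchy_iff _ (gaugeEMetric B F) l).1 h1).2 ε hε
  obtain ⟨Θ, hΘ⟩ := exists_tendsto_integral h0 hl'
  refine ⟨Θ, ?_⟩
  have hnhds : 𝓝 Θ = ⨅ F : {F : Set C₀(Eucl n, ℂ) // IsCompact F},
      @nhds _ (gaugeEMetric B F.1).toUniformSpace.toTopologicalSpace Θ :=
    (congrArg (fun t => @nhds _ t Θ) UniformSpace.toTopologicalSpace_iInf).trans nhds_iInf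
  rw [hnhds]
  refine le_iInf fun F => ?_
  refine (@Metric.nhds_basis_closedEBall _ (gaugeEMetric B F.1) Θ).ge_iff.2 fun ε hε => ?_
  obtain ⟨t, ht, h⟩ := hl' F.1 F.2 ε hε
  filter_upwards [ht] with Φ hΦ
  change gauge B F.1 (Φ - Θ) ≤ ε
  refine gauge_le_iff.2 fun K hK f hf => ?_
  rw [integral_coe_sub]
  refine le_of_tendsto ((hΘ K f).const_sub _).enorm ?_
  filter_upwards [ht] with Ψ hΨ
  rw [← integral_coe_sub]
  exact (enorm_integral_le_gauge (Φ - Ψ) hK hf).trans (h Φ hΦ Ψ hΨ).le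

theorem exists_tendsto_variationSeminorm (hB : Bornology.IsBounded B)
    (h0 : (0 : Eucl n) ∈ interior B) (u : ℕ → Curv n)
    (hu : ∀ ε : ℝ, 0 < ε → ∃ s₀ : ℕ, ∀ s t : ℕ, s₀ ≤ s → s₀ ≤ t →
      variationSeminorm hB (u s - u t) < ε) :
    ∃ Φ, Tendsto (fun s => variationSeminorm hB (u s - Φ)) atTop (𝓝 0) := by
  have hl : ∀ F : Set C₀(Eucl n, ℂ), IsCompact F → ∀ ε : ℝ≥0∞, 0 < ε →
      ∃ t ∈ map u atTop, ∀ Φ ∈ t, ∀ Ψ ∈ t, gauge B F (Φ - Ψ) < ε := by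
    intro F hF ε hε
    obtain ⟨c, hc⟩ := exists_gauge_le hF
    obtain ⟨δ, hδ, hδε⟩ := ENNReal.exists_nnreal_pos_mul_lt (a := c) ENNReal.coe_ne_top hε.ne'
    obtain ⟨s₀, hs₀⟩ := hu δ hδ
    refine ⟨_, image_mem_map (Ici_mem_atTop s₀), ?_⟩
    rintro _ ⟨s, hs, rfl⟩ _ ⟨t, ht, rfl⟩
    refine (hc B _).trans_lt (lt_of_le_of_lt ?_ hδε)
    gcongr
    rw [← ofReal_variationSeminorm hB, ← ENNReal.ofReal_coe_nnreal]
    exact ENNReal.ofReal_le_ofReal (hs₀ s t hs ht).le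
  obtain ⟨Θ, hΘ⟩ := exists_tendsto_integral h0 hl
  refine ⟨Θ, Metric.tendsto_atTop.2 fun ε hε => ?_⟩
  obtain ⟨s₀, hs₀⟩ := hu (ε / 2) (half_pos hε)
  refine ⟨s₀, fun s hs => ?_⟩
  rw [Real.dist_0_eq_abs, abs_of_nonneg (apply_nonneg _ _)]
  refine lt_of_le_of_lt ?_ (half_lt_self hε)
  rw [← ENNReal.ofReal_le_ofReal_iff (half_pos hε).le, ofReal_variationSeminorm]
  refine variationGauge_le_iff.2 fun K hK => variation_univ_le _ fun f hf => ?_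
  rw [integral_coe_sub]
  refine le_of_tendsto ((tendsto_map'_iff.1 (hΘ K f)).const_sub _).enorm ?_
  filter_upwards [Ici_mem_atTop s₀] with t ht
  rw [Function.comp_apply, ← integral_coe_sub]
  have h1 := variationGauge_le_iff.1 (ofReal_variationSeminorm hB (u s - u t)).ge K hK
  have h2 : ‖f‖ₑ ≤ 1 := by
    rw [← ofReal_norm, ← ENNReal.ofReal_one]
    exact ENNReal.ofReal_le_ofReal hf
  calc ‖integral ((u s - u t).1 K) f‖ₑ ≤ ((u s - u t).1 K).variation Set.univ * ‖f‖ₑ :=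
        enorm_integral_le_variation_mul _ f
    _ ≤ ENNReal.ofReal (variationSeminorm hB (u s - u t)) * 1 := mul_le_mul' h1 h2
    _ ≤ ENNReal.ofReal (ε / 2) := by
        rw [mul_one]
        exact ENNReal.ofReal_le_ofReal (hs₀ s t hs ht).le

end CurvatureMeasure

theorem mainTheorem12 (n : ℕ) (B : Set (CurvatureMeasure.Eucl n))
    (hB : Bornology.IsBounded B) (h0 : (0 : CurvatureMeasure.Eucl n) ∈ interior B) :
    (letI : UniformSpace (CurvatureMeasure.Curv n) := CurvatureMeasure.compactConvergence B
     (∃ p : SeminormFamily ℂ (CurvatureMeasure.Curv n)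
          {F : Set C₀(CurvatureMeasure.Eucl n, ℂ) // IsCompact F},
        (∀ F Φ, ENNReal.ofReal (p F Φ) = CurvatureMeasure.gauge B F.1 Φ) ∧ WithSeminorms p) ∧
     IsUniformAddGroup (CurvatureMeasure.Curv n) ∧
     ContinuousSMul ℂ (CurvatureMeasure.Curv n) ∧
     LocallyConvexSpace ℝ (CurvatureMeasure.Curv n) ∧
     T2Space (CurvatureMeasure.Curv n) ∧
     CompleteSpace (CurvatureMeasure.Curv n)) ∧
    (∃ N : Seminorm ℂ (CurvatureMeasure.Curv n),
      (∀ Φ, ENNReal.ofReal (N Φ) = CurvatureMeasure.variationGauge B Φ) ∧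
      (∀ Φ, N Φ = 0 → Φ = 0) ∧
      ∀ u : ℕ → CurvatureMeasure.Curv n,
        (∀ ε : ℝ, 0 < ε → ∃ s₀ : ℕ, ∀ s t : ℕ, s₀ ≤ s → s₀ ≤ t → N (u s - u t) < ε) →
        ∃ Φ, Tendsto (fun s => N (u s - Φ)) atTop (𝓝 0)) := by
  open CurvatureMeasure in
  refine ⟨?_, variationSeminorm hB, ofReal_variationSeminorm hB, fun Φ hΦ => ?_,
    exists_tendsto_variationSeminorm hB h0⟩
  · let _ : UniformSpace (Curv n) := compactConvergence B
    have hadd : IsUniformAddGroup (Curv n) := isUniformAddGroup_compactConvergence hB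
    let p : SeminormFamily ℂ (Curv n) {F : Set C₀(Eucl n, ℂ) // IsCompact F} :=
      fun F => gaugeSeminorm hB F.2
    have hp : WithSeminorms p :=
      p.withSeminorms_iff_uniformSpace_eq_iInf.2 (compactConvergence_eq hB)
    have hT1 : T1Space (Curv n) := hp.T1_of_separating fun Φ hΦ => by
      by_contra! h
      refine hΦ (eq_zero_of_gauge_eq_zero h0 fun F hF => ?_)
      rw [← ofReal_gaugeSeminorm hB hF]
      have h1 : gaugeSeminorm hB hF Φ = 0 := h ⟨F, hF⟩
      rw [h1, ENNReal.ofReal_zero]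
    exact ⟨⟨p, fun F => ofReal_gaugeSeminorm hB F.2, hp⟩, hadd, hp.continuousSMul,
      hp.toLocallyConvexSpace, inferInstance, completeSpace_compactConvergence h0⟩
  · refine eq_zero_of_gauge_eq_zero h0 fun F hF => ?_
    obtain ⟨c, hc⟩ := exists_gauge_le hF
    have h1 := hc B Φ
    rw [← ofReal_variationSeminorm hB, hΦ, ENNReal.ofReal_zero, zero_mul] at h1
    exact le_antisymm h1 zero_le
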